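/- **Setting.** Let $\mathcal G=(\mathcal N,\mathcal E)$ be a connected undirected graph with $N=|\mathcal N|\ge 2$ nodes, degrees $d_i$ and Laplacian $\Omega$. For each node $i$ let $F_i=\rho_i+\gamma_i$ on $\mathbb R^n$, where $\gamma_i$ is convex, bounded below and differentiable with $L_{\gamma_i}$-Lipschitz gradient, and $\rho_i$ is convex with $\tau_i\|x\|_2\le\rho_i(x)$ for all $x$ (for some $\tau_i>0$) and with a uniformly bounded subdifferential. Let $F^*=\min_{x\in\mathbb R^n}\sum_iF_i(x)$. Call $\mathbf x=(x_i)_{i\in\mathcal N}\in\mathbb R^{nN}$ *$\epsilon$-optimal* if $|\sum_iF_i(x_i)-F^*|\le\epsilon$ and *$\epsilon$-feasible* if $\|x_i-x_j\|_2\le\epsilon$ for all $(i,j)\in\mathcal E$. Let $A$ be a real matrix with $A^{\mathsf T}A=\Omega\otimes I_n$. **DFAL.** Let $c\in(0,1)$ and $\lambda^{(1)},\alpha^{(1)},\xi^{(1)}>0$ with $\xi^{(1)}/\lambda^{(1)}<\min_i\tau_i$, and set $\lambda^{(k+1)}=c\lambda^{(k)}$, $\alpha^{(k+1)}=c^2\alpha^{(k)}$,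 $\xi^{(k+1)}=c^2\xi^{(k)}$, $\theta^{(1)}=0$, $\theta^{(k+1)}=\theta^{(k)}-A\mathbf x^{(k)}/\lambda^{(k)}$. With $$f^{(k)}(\mathbf x)=\lambda^{(k)}\sum_i\gamma_i(x_i)+\tfrac12\|A\mathbf x-\lambda^{(k)}\theta^{(k)}\|_2^2,\qquad P^{(k)}(\mathbf x)=\lambda^{(k)}\sum_i\rho_i(x_i)+f^{(k)}(\mathbf x),$$ the conditions on the $k$-th iterate are: (a) $P^{(k)}(\mathbf x^{(k)})-\min P^{(k)}\le\alpha^{(k)}$; (b) there are $g_i\in\lambda^{(k)}\partial\rho_i(x^{(k)}_i)+\nabla_{x_i}f^{(k)}(\mathbf x^{(k)})$ with $\max_i\|g_i\|_2\le\xi^{(k)}/\sqrt N$. Iteration $k$ is *successful* if (a) or (b) holds. For $\bar C>0$ let $N(\epsilon)=\max\{1,\lceil\log_{1/c}(\bar C/\epsilon)\rceil\}$. A random sequence $(\mathbf x^{(k)})$ is a *run of asynchronous DFAL* (with parameters $\epsilon,p$) if for every $1\le k\le N(\epsilon)$, conditionally on iterations $1,\dots,k-1$ all being successful, iteration $k$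 is successful with probability at least $(1-p)^{1/N(\epsilon)}$. **ARBCD.** To minimize $\sum_ig_i(y_i)+f(\mathbf y)$ with step constants $L_i>0$ from $\mathbf z^{(0)}$, put $\mathbf u^{(0)}=0$, $t^{(0)}=1$. Iteration $\ell\ge0$ draws a node $i$ uniformly, independently of the past, sets $$z_i^{(\ell+1)}=\mathrm{prox}_{t^{(\ell)}g_i/L_i}\Big(z_i^{(\ell)}-\tfrac{t^{(\ell)}}{L_i}\nabla_{y_i}f\big((Nt^{(\ell)})^{-2}\mathbf u^{(\ell)}+\mathbf z^{(\ell)}\big)\Big),\quad u_i^{(\ell+1)}=u_i^{(\ell)}+N^2t^{(\ell)}(1-t^{(\ell)})(z_i^{(\ell+1)}-z_i^{(\ell)}),$$ keeps all other blocks, and sets $t^{(\ell+1)}=\big(1+\sqrt{1+(2Nt^{(\ell)})^2}\big)/(2N)$. The output after $T+1$ iterations is $(Nt^{(T)})^{-2}\mathbf u^{(T+1)}+\mathbf z^{(T+1)}$. **Theorem.** There is $\bar C>0$, not depending on $\epsilon$, $p$ or $\mathbf x^{(0)}$, such that: 1. For all $\epsilon>0$ and $p\in(0,1)$, every run of asynchronous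 DFAL with parameters $\epsilon,p$ satisfies $$\mathbb P\big(\mathbf x^{(N(\epsilon))}\text{ is $\epsilon$-optimal and $\epsilon$-feasible}\big)\ge1-p .$$ 2. For every $\mathbf x^{(0)}$ there are $M,\epsilon_0>0$ such that for all $\epsilon\in(0,\epsilon_0)$ and $p\in(0,1)$ there are integers $K_k,T_k\ge1$ with $$\sum_{k=1}^{N(\epsilon)}K_kT_k\le\frac M\epsilon\Big(\log\frac1p+\log\log\frac1\epsilon\Big)$$ for which the following holds. Let $\mathbf x^{(k)}$ be an output with least value of $P^{(k)}$ among those of $K_k$ independent calls of ARBCD for $\min P^{(k)}$ (with $g_i=\lambda^{(k)}\rho_i$, $f=f^{(k)}$, step constants $\lambda^{(k)}L_{\gamma_i}+d_i$), each started at $\mathbf x^{(k-1)}$ and run for $T_k$ iterations. Then $(\mathbf x^{(k)})$ is a run of asynchronous DFAL with parameters $\epsilon,p$, and $\mathbf x^{(N(\epsilon))}$ is $\epsilon$-optimal and $\epsilon$-feasible with probability at least $1-p$. So $O\big(\epsilon^{-1}(\log\frac1p+\log\log\frac1\epsilon)\big)$ ARBCD iterations in total suffice. -/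

import Mathlib

open MeasureTheory ProbabilityTheory
open scoped NNReal Matrix Kronecker

noncomputable section

namespace AsyncDFAL

/-- A vector of `ℝ^{nN}`, in blocks `x i ∈ ℝⁿ` (Euclidean norm), one block for each node `i`. -/
abbrev Blocks (V : Type*) (n : ℕ) : Type _ := V → EuclideanSpace ℝ (Fin n)

/-! ### Convex-analytic notions -/

/-- The subdifferential `∂ρ(x)` of a finite convex function. -/
def subdiff {n : ℕ} (ρ : EuclideanSpace ℝ (Fin n) → ℝ) (x : EuclideanSpace ℝ (Fin n)) :
    Set (EuclideanSpace ℝ (Fin n)) :=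
  {q | ∀ y, ρ x + inner ℝ q (y - x) ≤ ρ y}

/-- `prox_g(x) = argmin_y { g(y) + ½‖y - x‖² }` (unique for a finite convex `g`). -/
def prox {n : ℕ} (g : EuclideanSpace ℝ (Fin n) → ℝ) (x : EuclideanSpace ℝ (Fin n)) :
    EuclideanSpace ℝ (Fin n) :=
  Classical.epsilon fun z => IsMinOn (fun y => g y + 1 / 2 * ‖y - x‖ ^ 2) Set.univ z

/-- The partial gradient `∇_{x_i} f(x)`: the gradient of `y ↦ f(y; x_{-i})` at `y = x_i`. -/
def blockGrad {V : Type*} [DecidableEq V] {n : ℕ} (f : Blocks V n → ℝ) (i : V)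
    (x : Blocks V n) : EuclideanSpace ℝ (Fin n) :=
  gradient (fun y => f (Function.update x i y)) (x i)

/-- The class `Γ`: convex, bounded below, with an `L`-Lipschitz continuous gradient. -/
structure IsSmoothTerm {n : ℕ} (γ : EuclideanSpace ℝ (Fin n) → ℝ) (L : ℝ≥0) : Prop where
  convex : ConvexOn ℝ Set.univ γ
  differentiable : Differentiable ℝ γ
  lipschitz : LipschitzWith L (gradient γ)
  bddBelow : ∃ m : ℝ, ∀ x, m ≤ γ x

/-- The class `R`: convex, with a uniformly bounded subdifferential, and `ρ ≥ τ‖·‖`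
for the constant `τ > 0`. -/
structure IsNonsmoothTerm {n : ℕ} (ρ : EuclideanSpace ℝ (Fin n) → ℝ) (τ : ℝ) : Prop where
  convex : ConvexOn ℝ Set.univ ρ
  subdiff_bounded : ∃ B : ℝ, 0 < B ∧ ∀ x, ∀ q ∈ subdiff ρ x, ‖q‖ ≤ B
  tau_pos : 0 < τ
  coercive : ∀ x, τ * ‖x‖ ≤ ρ x

/-! ### The accelerated randomized block coordinate descent method (ARBCD) -/

section ARBCD

variable {V : Type*} [Fintype V] [DecidableEq V] {n : ℕ}

/-- The variables `z`, `u`, `t` of ARBCD. -/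
structure ARBCDState (V : Type*) (n : ℕ) where
  z : Blocks V n
  u : Blocks V n
  t : ℝ

/-- The point `(1 / (N t))² u + z`. -/
def extrapolate (t : ℝ) (u z : Blocks V n) : Blocks V n :=
  (1 / ((Fintype.card V : ℝ) * t)) ^ 2 • u + z

/-- One ARBCD iteration for `min ∑ᵢ gᵢ(yᵢ) + f(y)` with step constants `Lip i`,
when node `i` is drawn. -/
def arbcdStep (g : V → EuclideanSpace ℝ (Fin n) → ℝ) (f : Blocks V n → ℝ) (Lip : V → ℝ)
    (i : V) (s : ARBCDState V n) : ARBCDState V n :=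
  let N : ℝ := Fintype.card V
  let zi := prox (fun y => s.t / Lip i * g i y)
    (s.z i - (s.t / Lip i) • blockGrad f i (extrapolate s.t s.u s.z))
  { z := Function.update s.z i zi
    u := Function.update s.u i (s.u i + (N ^ 2 * s.t * (1 - s.t)) • (zi - s.z i))
    t := (1 + √(1 + (2 * N * s.t) ^ 2)) / (2 * N) }

/-- The ARBCD variables after `ℓ` iterations started at `z0`, when node `idx m` is drawn
in iteration `m`. -/
def arbcdState (g : V → EuclideanSpace ℝ (Fin n) → ℝ) (f : Blocks V n → ℝ) (Lip : V → ℝ)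
    (z0 : Blocks V n) (idx : ℕ → V) : ℕ → ARBCDState V n
  | 0 => { z := z0, u := 0, t := 1 }
  | ℓ + 1 => arbcdStep g f Lip (idx ℓ) (arbcdState g f Lip z0 idx ℓ)

/-- The output `(1 / (N t^(T)))² u^(T+1) + z^(T+1)` of a call to ARBCD; it performs
`T + 1` iterations. -/
def arbcdOutput (g : V → EuclideanSpace ℝ (Fin n) → ℝ) (f : Blocks V n → ℝ) (Lip : V → ℝ)
    (z0 : Blocks V n) (idx : ℕ → V) (T : ℕ) : Blocks V n :=
  extrapolate (arbcdState g f Lip z0 idx T).t (arbcdState g f Lip z0 idx (T + 1)).u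
    (arbcdState g f Lip z0 idx (T + 1)).z

open Classical in
/-- A point with the smallest value of `Φ` among `y 0, …, y r`. -/
def bestOf {X : Type*} (Φ : X → ℝ) (y : ℕ → X) : ℕ → X
  | 0 => y 0
  | r + 1 => if Φ (y (r + 1)) < Φ (bestOf Φ y r) then y (r + 1) else bestOf Φ y r

end ARBCD

/-! ### The DFAL algorithm

The outer iterations are numbered `k = 0, 1, 2, …`: iteration `k` uses the parameters
`lam k = λ^(k+1)`, `alpha k = α^(k+1)`, `xi k = ξ^(k+1)` and the dual vector `θ^(k+1)`, and
it turns the iterate `x k = x^(k)` into `x (k + 1) = x^(k+1)`. -/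

/-- The data of DFAL: the local cost functions `F_i = ρ_i + γ_i`, the matrix `A` of the
constraint `A x = 0`, and the parameters `c, λ^(1), α^(1), ξ^(1)`. -/
structure Data (V κ : Type*) (n : ℕ) where
  ρ : V → EuclideanSpace ℝ (Fin n) → ℝ
  γ : V → EuclideanSpace ℝ (Fin n) → ℝ
  A : Matrix κ (V × Fin n) ℝ
  c : ℝ
  lam₁ : ℝ
  alpha₁ : ℝ
  xi₁ : ℝ

namespace Data

variable {V κ : Type*} [Fintype V] [DecidableEq V] [Fintype κ] {n : ℕ}

/-- The product `A x` of the matrix with the stacked vector `x ∈ ℝ^{nN}`. -/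
def mulA (D : Data V κ n) (x : Blocks V n) : EuclideanSpace ℝ κ :=
  WithLp.toLp 2 (D.A.mulVec fun q => x q.1 q.2)

/-- `λ^(k+1)`. -/
def lam (D : Data V κ n) (k : ℕ) : ℝ := D.lam₁ * D.c ^ k

/-- `α^(k+1)`. -/
def alpha (D : Data V κ n) (k : ℕ) : ℝ := D.alpha₁ * (D.c ^ 2) ^ k

/-- `ξ^(k+1)`. -/
def xi (D : Data V κ n) (k : ℕ) : ℝ := D.xi₁ * (D.c ^ 2) ^ k

/-- The dual vectors along a sequence `x` of iterates: `D.dual x k = θ^(k+1)`, with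
`θ^(1) = 0` and `θ^(k+2) = θ^(k+1) - A x^(k+1) / λ^(k+1)`. -/
def dual (D : Data V κ n) (x : ℕ → Blocks V n) : ℕ → EuclideanSpace ℝ κ
  | 0 => 0
  | k + 1 => D.dual x k - (D.lam k)⁻¹ • D.mulA (x (k + 1))

/-- The smooth part `f(x) = λ ∑ᵢ γᵢ(xᵢ) + ½‖A x - λ θ‖²` of the subproblem of iteration `k`
with dual vector `θ`. -/
def smoothPart (D : Data V κ n) (k : ℕ) (θ : EuclideanSpace ℝ κ) (x : Blocks V n) : ℝ :=
  D.lam k * ∑ i, D.γ i (x i) + 1 / 2 * ‖D.mulA x - D.lam k • θ‖ ^ 2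

/-- The objective `P(x) = λ ∑ᵢ ρᵢ(xᵢ) + f(x)` of the subproblem of iteration `k`. -/
def subproblem (D : Data V κ n) (k : ℕ) (θ : EuclideanSpace ℝ κ) (x : Blocks V n) : ℝ :=
  D.lam k * ∑ i, D.ρ i (x i) + D.smoothPart k θ x

/-- Condition (a) for the result `x` of iteration `k`: `P(x) - P(x_*) ≤ α` for a minimizer `x_*`. -/
def CondA (D : Data V κ n) (k : ℕ) (θ : EuclideanSpace ℝ κ) (x : Blocks V n) : Prop :=
  ∃ xs, IsMinOn (D.subproblem k θ) Set.univ xs ∧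
    D.subproblem k θ x - D.subproblem k θ xs ≤ D.alpha k

/-- Condition (b): there are `gᵢ ∈ λ ∂ρᵢ(xᵢ) + ∇_{x_i} f(x)` with `maxᵢ ‖gᵢ‖ ≤ ξ / √N`. -/
def CondB (D : Data V κ n) (k : ℕ) (θ : EuclideanSpace ℝ κ) (x : Blocks V n) : Prop :=
  ∃ g : Blocks V n,
    (∀ i, ∃ q ∈ subdiff (D.ρ i) (x i), g i = D.lam k • q + blockGrad (D.smoothPart k θ) i x) ∧
    ∀ i, ‖g i‖ ≤ D.xi k / √(Fintype.card V : ℝ)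

/-- The result `x (k + 1)` of outer iteration `k` satisfies (a) or (b). -/
def Accepted (D : Data V κ n) (x : ℕ → Blocks V n) (k : ℕ) : Prop :=
  D.CondA k (D.dual x k) (x (k + 1)) ∨ D.CondB k (D.dual x k) (x (k + 1))

/-- The integer `N(ε)`: the least integer `≥ 1` that is at least `log_{1/c}(Cbar / ε)`. -/
def outerIters (D : Data V κ n) (Cbar ε : ℝ) : ℕ := max 1 ⌈Real.logb (1 / D.c) (Cbar / ε)⌉₊

/-- The acceptance condition of the asynchronous variant for a random sequence `x` of iterates:
in each of the first `M` outer iterations, given that all the previous iterations were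
successful, (a) or (b) holds with probability at least `(1 - p)^(1/M)`. -/
def AsyncAccepted (D : Data V κ n) {Ω : Type*} [MeasurableSpace Ω] (μ : Measure Ω)
    (x : ℕ → Ω → Blocks V n) (M : ℕ) (p : ℝ) : Prop :=
  ∀ k < M, (1 - p) ^ (1 / (M : ℝ)) ≤
    (ProbabilityTheory.cond μ {ω | ∀ j < k, D.Accepted (fun l => x l ω) j}).real
      {ω | D.Accepted (fun l => x l ω) k}

/-- `ε`-optimal: `|∑ᵢ Fᵢ(xᵢ) - F*| ≤ ε`, where `F* = min_{x ∈ ℝⁿ} ∑ᵢ Fᵢ(x)`. -/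
def EpsOptimal (D : Data V κ n) (ε : ℝ) (x : Blocks V n) : Prop :=
  |∑ i, (D.ρ i (x i) + D.γ i (x i)) -
    ⨅ y : EuclideanSpace ℝ (Fin n), ∑ i, (D.ρ i y + D.γ i y)| ≤ ε

/-- DFAL with ARBCD as the subproblem solver, for step constants `Lip k i` and given sampled
nodes: outer iteration `k` makes `K k + 1` calls to ARBCD started at the current iterate, of
`T k + 1` iterations each (the node drawn in iteration `ℓ` of call `r` is `R k r ℓ`), and keeps
a best output. The value at `k` is `(x^(k), θ^(k+1))`. -/
def arbcdRun (D : Data V κ n) (Lip : ℕ → V → ℝ) (K T : ℕ → ℕ) (x0 : Blocks V n)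
    (R : ℕ → ℕ → ℕ → V) : ℕ → Blocks V n × EuclideanSpace ℝ κ
  | 0 => (x0, 0)
  | k + 1 =>
    let x := (D.arbcdRun Lip K T x0 R k).1
    let θ := (D.arbcdRun Lip K T x0 R k).2
    let x' := bestOf (D.subproblem k θ)
      (fun r => arbcdOutput (fun i y => D.lam k * D.ρ i y) (D.smoothPart k θ) (Lip k) x
        (R k r) (T k)) (K k)
    (x', θ - (D.lam k)⁻¹ • D.mulA x')

/-- The dual vectors produced by the run are those of its sequence of iterates. -/
theorem arbcdRun_snd (D : Data V κ n) (Lip : ℕ → V → ℝ) (K T : ℕ → ℕ) (x0 : Blocks V n)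
    (R : ℕ → ℕ → ℕ → V) (k : ℕ) :
    (D.arbcdRun Lip K T x0 R k).2 = D.dual (fun l => (D.arbcdRun Lip K T x0 R l).1) k := by
  induction k with
  | zero => rfl
  | succ k ih => simp only [dual, ← ih]; rfl

end Data

/-- `ε`-feasible: `‖x_i - x_j‖ ≤ ε` for every edge `(i, j)`. -/
def EpsFeasible {V : Type*} (G : SimpleGraph V) {n : ℕ} (ε : ℝ) (x : Blocks V n) : Prop :=
  ∀ i j, G.Adj i j → ‖x i - x j‖ ≤ ε

/-- The sampled nodes `R · k r ℓ` are independent and uniformly distributed over the nodes. -/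
structure IsUniformSampling {V Ω : Type*} [Fintype V] [MeasurableSpace Ω] (μ : Measure Ω)
    (R : Ω → ℕ → ℕ → ℕ → V) : Prop where
  measurable : ∀ k r ℓ, Measurable[_, ⊤] fun ω => R ω k r ℓ
  uniform : ∀ k r ℓ (i : V), μ.real {ω | R ω k r ℓ = i} = 1 / (Fintype.card V : ℝ)
  indep : iIndepFun (m := fun _ : ℕ × ℕ × ℕ => (⊤ : MeasurableSpace V))
    (fun (s : ℕ × ℕ × ℕ) ω => R ω s.1 s.2.1 s.2.2) μ

end AsyncDFAL

end

set_option linter.unusedSectionVars false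

/-! Outer loop. Conditions (a) and (b) both imply one inequality, `NearMin`: P(x) ≤ P(w) + α + ξ
∑‖xᵢ - wᵢ‖ for every w. Tested at w = 0 it bounds ∑‖xᵢ‖ and ∑(γᵢ(xᵢ) - mᵢ), where mᵢ is a lower
bound of γᵢ, by a constant plus a multiple of λ‖θ‖², because ξ/λ stays below min τᵢ. Tested at
perturbations of a single block of length c^k, it keeps the blocks of Aᵀθ', with θ' the next dual
vector, within a fixed distance of the gradients ∇γᵢ(xᵢ). Since ‖∇γᵢ‖² is at most a multiple of γᵢ -
mᵢ, and Aᵀ is injective on the range of A, this gives ‖θ'‖ ≤ a + b c^(k/2) ‖θ‖. The factor tends to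
0, so the dual vectors are bounded (`exists_dual_bound`).

Now A x = λ(θ - θ') is O(c^k), which is feasibility. Comparing P at x and at a consensus minimizer,
and dividing by λ, bounds ∑Fᵢ(xᵢ) - F* above by O(c^k); replacing all blocks by one of them bounds
it below, because the Fᵢ are Lipschitz on bounded sets (`exists_rate`). Hence N(ε) successful
iterations suffice, and the conditional success probabilities multiply to at least 1 - p
(`async_guarantee`).

Inner solver. A Lyapunov function does not increase in mean over the drawn node
(`sum_lyapunov_succ_le`), so the mean gap after T iterations is O(1/T²). Along successful runs the
starting points and subproblem solutions stay in a fixed ball, and α is of order c^(2k); by Markov's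
inequality O(c^(-k)) iterations make a call succeed with probability at least 1/2
(`card_not_optimal_le`). Fresh samples are independent of the past, so K calls all fail with
probability at most 2^(-K), and K of order log(N(ε)/p) is enough (`asyncAccepted_of_card_badCall`).
The sum of c^(-k) is geometric and of order 1/ε, while N(ε) is of order log(1/ε): this is the stated
budget (`exists_budget`). -/

namespace AsyncDFAL

/-! ### Convex analysis: subgradients, the descent lemma, the proximal map. -/

section Convex

variable {n : ℕ}

theorem continuous_of_convexOn {ρ : EuclideanSpace ℝ (Fin n) → ℝ}
    (hρ : ConvexOn ℝ Set.univ ρ) : Continuous ρ :=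
  hρ.locallyLipschitz.continuous

/-- A finite convex function on `ℝⁿ` has a subgradient at each point. -/
theorem subdiff_nonempty {ρ : EuclideanSpace ℝ (Fin n) → ℝ} (hρ : ConvexOn ℝ Set.univ ρ)
    (x : EuclideanSpace ℝ (Fin n)) : (subdiff ρ x).Nonempty := by
  have hcont := continuous_of_convexOn hρ
  have hconv : Convex ℝ {p : EuclideanSpace ℝ (Fin n) × ℝ | ρ p.1 < p.2} := by
    have := hρ.convex_strict_epigraph
    simpa using this
  have hopen : IsOpen {p : EuclideanSpace ℝ (Fin n) × ℝ | ρ p.1 < p.2} :=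
    isOpen_lt (hcont.comp continuous_fst) continuous_snd
  -- The open strict epigraph is separated from its boundary point (x, ρ x). The functional turns
  -- out to be negative in the vertical direction, so dividing by `-β` turns it into a subgradient.
  obtain ⟨f, hf⟩ := geometric_hahn_banach_open_point (x := (x, ρ x)) hconv hopen
    (by simp)
  have hsplit : ∀ (y : EuclideanSpace ℝ (Fin n)) (r : ℝ), f (y, r) = f (y, 0) + r * f (0, 1) := by
    intro y r
    have : ((y, r) : EuclideanSpace ℝ (Fin n) × ℝ) = (y, 0) + r • ((0, 1) : _ × ℝ) := by
      ext <;> simp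
    rw [this, map_add, map_smul, smul_eq_mul]
  set β := f (0, 1) with hβ
  have hβneg : β < 0 := by
    have := hf (x, ρ x + 1) (by simp)
    rw [hsplit x (ρ x + 1), hsplit x (ρ x)] at this
    linarith
  have hle : ∀ y, f (y, 0) + ρ y * β ≤ f (x, 0) + ρ x * β := by
    intro y
    refine le_of_forall_pos_le_add fun e he => ?_
    have h := hf (y, ρ y + e / (-β)) (by simpa using div_pos he (by linarith))
    rw [hsplit y, hsplit x] at h
    have hβ0 : β ≠ 0 := hβneg.ne
    have : e / (-β) * β = -e := by field_simp
    nlinarith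
  let g : StrongDual ℝ (EuclideanSpace ℝ (Fin n)) :=
    (-β)⁻¹ • f.comp (ContinuousLinearMap.inl ℝ _ ℝ)
  refine ⟨(InnerProductSpace.toDual ℝ _).symm g, fun y => ?_⟩
  rw [InnerProductSpace.toDual_symm_apply]
  have h1 : g (y - x) = (-β)⁻¹ * (f (y, 0) - f (x, 0)) := by
    simp only [g, smul_apply, ContinuousLinearMap.comp_apply,
      ContinuousLinearMap.inl_apply, smul_eq_mul]
    rw [← map_sub]; simp
  rw [h1]
  have h2 := hle y
  have h3 : (-β)⁻¹ * (f (y, 0) - f (x, 0)) ≤ (-β)⁻¹ * ((ρ y - ρ x) * (-β)) :=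
    mul_le_mul_of_nonneg_left (by linarith) (inv_nonneg.2 (by linarith))
  have h4 : (-β)⁻¹ * ((ρ y - ρ x) * (-β)) = ρ y - ρ x := by
    have : β ≠ 0 := hβneg.ne
    field_simp
  linarith

/-- The subgradient inequality at x, followed by Cauchy–Schwarz; with x and y exchanged it makes ρ
Lipschitz. -/
theorem sub_le_of_subdiff_bounded {ρ : EuclideanSpace ℝ (Fin n) → ℝ}
    (hρ : ConvexOn ℝ Set.univ ρ) {B : ℝ} (hB : ∀ x, ∀ q ∈ subdiff ρ x, ‖q‖ ≤ B)
    (x y : EuclideanSpace ℝ (Fin n)) : ρ x - ρ y ≤ B * ‖x - y‖ := by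
  obtain ⟨q, hq⟩ := subdiff_nonempty hρ x
  have h1 := hq y
  have h2 : -inner ℝ q (y - x) ≤ ‖q‖ * ‖y - x‖ :=
    (neg_le_abs _).trans (abs_real_inner_le_norm q (y - x))
  rw [norm_sub_rev y x] at h2
  have h3 := mul_le_mul_of_nonneg_right (hB x q hq) (norm_nonneg (x - y))
  linarith

/-- First-order characterization of convexity. -/
theorem gradient_mem_subdiff {γ : EuclideanSpace ℝ (Fin n) → ℝ} (hγ : ConvexOn ℝ Set.univ γ)
    (hd : Differentiable ℝ γ) (x : EuclideanSpace ℝ (Fin n)) : gradient γ x ∈ subdiff γ x := by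
  obtain ⟨q, hq⟩ := subdiff_nonempty hγ x
  -- Any subgradient q makes x a minimizer of γ - ⟨q, ·⟩, which forces q to be the gradient.
  have hmin : IsLocalMin (fun y => γ y - inner ℝ q y) x := by
    refine Filter.Eventually.of_forall fun y => ?_
    have h := hq y
    rw [inner_sub_right] at h
    simp only
    linarith
  have hder : HasFDerivAt (fun y => γ y - inner ℝ q y) (fderiv ℝ γ x - innerSL ℝ q) x :=
    (hd x).hasFDerivAt.sub (innerSL ℝ q).hasFDerivAt
  have h0 := hmin.hasFDerivAt_eq_zero hder
  have : gradient γ x = q := by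
    refine ext_inner_right ℝ fun v => ?_
    rw [inner_gradient_left]
    have := congrArg (fun l => l v) h0
    simp only [sub_apply, innerSL_apply_apply,
      zero_apply] at this
    linarith
  rw [this]
  exact hq

/-- The descent lemma for a function with Lipschitz gradient. -/
theorem descent_lemma {γ : EuclideanSpace ℝ (Fin n) → ℝ} {L : ℝ≥0}
    (hd : Differentiable ℝ γ) (hL : LipschitzWith L (gradient γ))
    (x d : EuclideanSpace ℝ (Fin n)) :
    γ (x + d) ≤ γ x + inner ℝ (gradient γ x) d + L / 2 * ‖d‖ ^ 2 := by
  -- Along the segment from x to x + d, γ minus its quadratic model, up to a constant; the Lipschitz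
  -- bound makes its derivative nonpositive.
  let φ : ℝ → ℝ := fun s => γ (x + s • d) - s * inner ℝ (gradient γ x) d - L / 2 * ‖d‖ ^ 2 * s ^ 2
  have hder : ∀ s, HasDerivAt φ (inner ℝ (gradient γ (x + s • d)) d
      - inner ℝ (gradient γ x) d - L / 2 * ‖d‖ ^ 2 * (2 * s)) s := by
    intro s
    have h1 : HasDerivAt (fun s : ℝ => x + s • d) d s := by
      simpa using ((hasDerivAt_id s).smul_const d).const_add x
    have h2 : HasDerivAt (fun s : ℝ => γ (x + s • d)) (inner ℝ (gradient γ (x + s • d)) d) s := by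
      rw [inner_gradient_left]
      exact (hd _).hasFDerivAt.comp_hasDerivAt s h1
    have h3 : HasDerivAt (fun s : ℝ => s * inner ℝ (gradient γ x) d)
        (inner ℝ (gradient γ x) d) s := by
      simpa using (hasDerivAt_id s).mul_const (inner ℝ (gradient γ x) d)
    have h4 : HasDerivAt (fun s : ℝ => L / 2 * ‖d‖ ^ 2 * s ^ 2)
        (L / 2 * ‖d‖ ^ 2 * (2 * s)) s := by
      simpa using (hasDerivAt_pow 2 s).const_mul (L / 2 * ‖d‖ ^ 2)
    exact (h2.sub h3).sub h4
  have hanti : AntitoneOn φ (Set.Icc 0 1) := by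
    refine antitoneOn_of_deriv_nonpos (convex_Icc 0 1)
      (fun s _ => (hder s).continuousAt.continuousWithinAt)
      (fun s _ => (hder s).differentiableAt.differentiableWithinAt) fun s hs => ?_
    rw [interior_Icc] at hs
    rw [(hder s).deriv, ← inner_sub_left]
    have h1 : inner ℝ (gradient γ (x + s • d) - gradient γ x) d
        ≤ ‖gradient γ (x + s • d) - gradient γ x‖ * ‖d‖ := real_inner_le_norm _ _
    have h2 : ‖gradient γ (x + s • d) - gradient γ x‖ ≤ L * (s * ‖d‖) := by
      have := hL.norm_sub_le (x + s • d) x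
      rwa [add_sub_cancel_left, norm_smul, Real.norm_of_nonneg hs.1.le] at this
    have h3 := mul_le_mul_of_nonneg_right h2 (norm_nonneg d)
    nlinarith
  have h := hanti (Set.left_mem_Icc.2 zero_le_one) (Set.right_mem_Icc.2 zero_le_one) zero_le_one
  simp only [φ, one_smul, zero_smul, add_zero] at h
  linarith

/-- A gradient step of length 1/(L+1) lowers γ by at least ‖∇γ‖²/(2(L+1)) and cannot go below m.
Using L + 1 instead of L covers L = 0. -/
theorem norm_gradient_sq_le {γ : EuclideanSpace ℝ (Fin n) → ℝ} {L : ℝ≥0}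
    (hd : Differentiable ℝ γ) (hL : LipschitzWith L (gradient γ)) {m : ℝ} (hm : ∀ x, m ≤ γ x)
    (x : EuclideanSpace ℝ (Fin n)) : ‖gradient γ x‖ ^ 2 ≤ 2 * (L + 1) * (γ x - m) := by
  have h := descent_lemma hd hL x (-((L : ℝ) + 1)⁻¹ • gradient γ x)
  rw [inner_smul_right, real_inner_self_eq_norm_sq, norm_smul, mul_pow] at h
  have h1 := hm (x + -((L : ℝ) + 1)⁻¹ • gradient γ x)
  have hLpos : 0 < (L : ℝ) + 1 := by positivity
  have h2 : ‖-((L : ℝ) + 1)⁻¹‖ ^ 2 = ((L : ℝ) + 1)⁻¹ ^ 2 := by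
    rw [norm_neg, Real.norm_of_nonneg (by positivity)]
  rw [h2] at h
  set a := ‖gradient γ x‖ ^ 2 with ha
  have ha0 : 0 ≤ a := by positivity
  set K := (L : ℝ) + 1 with hK
  have h3 : (L : ℝ) / 2 * (K⁻¹ ^ 2 * a) ≤ K⁻¹ * a / 2 := by
    have : (L : ℝ) * K⁻¹ ≤ 1 := by
      rw [← div_eq_mul_inv, div_le_one hLpos]; linarith
    have h5 : 0 ≤ K⁻¹ * a := by positivity
    nlinarith
  have h4 : K⁻¹ * a / 2 ≤ γ x - m := by linarith
  have h5 : a = 2 * K * (K⁻¹ * a / 2) := by field_simp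
  rw [h5]
  exact mul_le_mul_of_nonneg_left h4 (by positivity)

/-- A continuous coercive function on `ℝⁿ`-blocks has a minimizer. -/
theorem exists_isMinOn_of_coercive {E : Type*} [NormedAddCommGroup E] [ProperSpace E]
    {h : E → ℝ} (hc : Continuous h) {a b : ℝ} (ha : 0 < a) (hcoer : ∀ x, a * ‖x‖ - b ≤ h x) :
    ∃ z, IsMinOn h Set.univ z := by
  have ht : Filter.Tendsto h (Filter.cocompact E) Filter.atTop := by
    refine Filter.tendsto_atTop_mono hcoer ?_
    exact Filter.tendsto_atTop_add_const_right _ (-b)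
      (Filter.Tendsto.const_mul_atTop ha tendsto_norm_cocompact_atTop)
  obtain ⟨z, hz⟩ := hc.exists_forall_le ht
  exact ⟨z, fun y _ => hz y⟩

/-- Nonnegativity of g makes the objective coercive, so the `Classical.epsilon` in `prox` picks a
genuine minimizer. -/
theorem isMinOn_prox {g : EuclideanSpace ℝ (Fin n) → ℝ} (hg : ConvexOn ℝ Set.univ g)
    (hg0 : ∀ x, 0 ≤ g x) (x : EuclideanSpace ℝ (Fin n)) :
    IsMinOn (fun y => g y + 1 / 2 * ‖y - x‖ ^ 2) Set.univ (prox g x) := by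
  have hc := continuous_of_convexOn hg
  refine Classical.epsilon_spec (p := fun z => IsMinOn (fun y => g y + 1 / 2 * ‖y - x‖ ^ 2)
    Set.univ z) (exists_isMinOn_of_coercive (a := 1) (b := ‖x‖ + 1 / 2) (by fun_prop) one_pos ?_)
  intro y
  have h1 := hg0 y
  have h2 : ‖y‖ - ‖x‖ ≤ ‖y - x‖ := norm_sub_norm_le y x
  nlinarith [sq_nonneg (‖y - x‖ - 1)]

/-- The three-point inequality of the proximal map. -/
theorem prox_three_point {g : EuclideanSpace ℝ (Fin n) → ℝ} (hg : ConvexOn ℝ Set.univ g)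
    (hg0 : ∀ x, 0 ≤ g x) (x w : EuclideanSpace ℝ (Fin n)) :
    g (prox g x) + 1 / 2 * ‖prox g x - x‖ ^ 2 + 1 / 2 * ‖w - prox g x‖ ^ 2
      ≤ g w + 1 / 2 * ‖w - x‖ ^ 2 := by
  set z := prox g x with hz
  have hmin := isMinOn_prox hg hg0 x
  rw [← hz] at hmin
  -- Minimality of z is tested on the segment towards w and divided by a; the limit a → 0 recovers
  -- the full quadratic term.
  have key : ∀ a : ℝ, 0 < a → a ≤ 1 →
      g z + 1 / 2 * ‖z - x‖ ^ 2 + 1 / 2 * (1 - a) * ‖w - z‖ ^ 2 ≤ g w + 1 / 2 * ‖w - x‖ ^ 2 := by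
    intro a ha ha1
    have h1 := hmin (Set.mem_univ ((1 - a) • z + a • w))
    simp only [Set.mem_ofPred_eq] at h1
    have h2 := hg.2 (Set.mem_univ z) (Set.mem_univ w) (by linarith : 0 ≤ 1 - a) ha.le (by ring)
    simp only [smul_eq_mul] at h2
    have e1 : (1 - a) • z + a • w - x = (z - x) + a • (w - z) := by module
    have e2 : w - x = (z - x) + (w - z) := by abel
    have e3 : ‖w - x‖ ^ 2 = ‖z - x‖ ^ 2 + 2 * inner ℝ (z - x) (w - z) + ‖w - z‖ ^ 2 := by
      rw [e2]; exact norm_add_sq_real _ _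
    rw [e1, norm_add_sq_real, inner_smul_right, norm_smul, Real.norm_of_nonneg ha.le] at h1
    rw [e3]
    have h3 : 0 ≤ a * (g w - g z + inner ℝ (z - x) (w - z) + 1 / 2 * a * ‖w - z‖ ^ 2) := by
      nlinarith
    have h4 := nonneg_of_mul_nonneg_right h3 ha
    linarith
  have hlim : Filter.Tendsto (fun a : ℝ =>
      g z + 1 / 2 * ‖z - x‖ ^ 2 + 1 / 2 * (1 - a) * ‖w - z‖ ^ 2) (nhdsWithin 0 (Set.Ioi 0))
      (nhds (g z + 1 / 2 * ‖z - x‖ ^ 2 + 1 / 2 * (1 - 0) * ‖w - z‖ ^ 2)) := by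
    apply tendsto_nhdsWithin_of_tendsto_nhds
    exact Continuous.tendsto (by fun_prop) 0
  have := le_of_tendsto hlim (b := g w + 1 / 2 * ‖w - x‖ ^ 2) (by
    filter_upwards [Ioc_mem_nhdsGT (zero_lt_one (α := ℝ))] with a ha
    exact key a ha.1 ha.2)
  simpa using this

/-- A vector along which a penalized quadratic model cannot decrease by more than `α` is small. -/
theorem norm_le_of_forall_inner_ge {g : EuclideanSpace ℝ (Fin n)} {α b l s : ℝ} (hs : 0 < s)
    (hα : 0 ≤ α) (hb : 0 ≤ b) (hl : 0 ≤ l)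
    (h : ∀ d, -α ≤ b * ‖d‖ + inner ℝ g d + l / 2 * ‖d‖ ^ 2) :
    ‖g‖ ≤ α / s + b + l / 2 * s := by
  rcases eq_or_ne g 0 with rfl | hg
  · rw [norm_zero]; positivity
  have hgp : 0 < ‖g‖ := norm_pos_iff.2 hg
  have h1 := h (-(s / ‖g‖) • g)
  rw [inner_smul_right, real_inner_self_eq_norm_sq, norm_smul, norm_neg,
    Real.norm_of_nonneg (by positivity), div_mul_cancel₀ _ hgp.ne'] at h1
  have h2 : -(s / ‖g‖) * ‖g‖ ^ 2 = -(s * ‖g‖) := by field_simp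
  rw [h2] at h1
  have h3 : s * ‖g‖ ≤ s * (α / s + b + l / 2 * s) := by
    have : s * (α / s) = α := by field_simp
    nlinarith
  exact le_of_mul_le_mul_left h3 hs

end Convex

end AsyncDFAL

namespace AsyncDFAL

/-! ### Step sizes of ARBCD -/

/-- The step sizes `t^(ℓ)` of ARBCD with `N` blocks. -/
noncomputable def stepSize (N : ℝ) : ℕ → ℝ
  | 0 => 1
  | ℓ + 1 => (1 + √(1 + (2 * N * stepSize N ℓ) ^ 2)) / (2 * N)

/-- The new step size is the positive root of t² - t/N = (previous t)². This identity makes the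
weights of the Lyapunov function telescope. -/
theorem stepSize_succ_sq {N : ℝ} (hN : 0 < N) (ℓ : ℕ) :
    stepSize N (ℓ + 1) ^ 2 - stepSize N (ℓ + 1) / N = stepSize N ℓ ^ 2 := by
  have h : √(1 + (2 * N * stepSize N ℓ) ^ 2) ^ 2 = 1 + (2 * N * stepSize N ℓ) ^ 2 :=
    Real.sq_sqrt (by positivity)
  simp only [stepSize]
  generalize √(1 + (2 * N * stepSize N ℓ) ^ 2) = r at h ⊢
  field_simp
  linear_combination h

theorem stepSize_succ_ge {N : ℝ} (hN : 0 < N) (ℓ : ℕ) :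
    stepSize N ℓ + 1 / (2 * N) ≤ stepSize N (ℓ + 1) := by
  have h : 2 * N * stepSize N ℓ ≤ √(1 + (2 * N * stepSize N ℓ) ^ 2) :=
    Real.le_sqrt_of_sq_le (by linarith)
  rw [stepSize, le_div_iff₀ (by positivity)]
  have : (stepSize N ℓ + 1 / (2 * N)) * (2 * N) = 2 * N * stepSize N ℓ + 1 := by field_simp
  linarith

theorem stepSize_ge {N : ℝ} (hN : 0 < N) (ℓ : ℕ) : 1 + ℓ / (2 * N) ≤ stepSize N ℓ := by
  induction ℓ with
  | zero => simp [stepSize]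
  | succ ℓ ih =>
    have := stepSize_succ_ge hN ℓ
    push_cast
    rw [add_div]
    linarith

theorem one_le_stepSize {N : ℝ} (hN : 0 < N) (ℓ : ℕ) : 1 ≤ stepSize N ℓ :=
  le_trans (by have : 0 ≤ (ℓ : ℝ) / (2 * N) := by positivity
               linarith) (stepSize_ge hN ℓ)

theorem convexOn_sum_blocks {V : Type*} [Fintype V] {n : ℕ} {g : V → EuclideanSpace ℝ (Fin n) → ℝ}
    (hg : ∀ i, ConvexOn ℝ Set.univ (g i)) :
    ConvexOn ℝ Set.univ fun x : Blocks V n => ∑ i, g i (x i) := by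
  refine ⟨convex_univ, fun x _ y _ a b ha hb hab => ?_⟩
  rw [smul_eq_mul, smul_eq_mul, Finset.mul_sum, Finset.mul_sum, ← Finset.sum_add_distrib]
  exact Finset.sum_le_sum fun i _ =>
    (hg i).2 (Set.mem_univ (x i)) (Set.mem_univ (y i)) ha hb hab

/-- A nonnegative combination of two bounded values is attained by a convex combination. -/
theorem exists_combination {E : Type*} [AddCommGroup E] [Module ℝ E] {ψ : E → ℝ}
    (hψ : ConvexOn ℝ Set.univ ψ) (w z : E) {ω p q : ℝ} (hω : ψ w ≤ ω) (hp : 0 ≤ p)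
    (hq : 0 ≤ q) : ∃ w' ω', ψ w' ≤ ω' ∧ p • w + q • z = (p + q) • w' ∧
      p * ω + q * ψ z = (p + q) * ω' := by
  rcases eq_or_lt_of_le (add_nonneg hp hq) with h | h
  · have hp0 : p = 0 := by linarith
    have hq0 : q = 0 := by linarith
    exact ⟨z, ψ z, le_rfl, by simp [hp0, hq0], by simp [hp0, hq0]⟩
  · refine ⟨(p / (p + q)) • w + (q / (p + q)) • z, p / (p + q) * ω + q / (p + q) * ψ z, ?_, ?_, ?_⟩
    · have h1 := hψ.2 (Set.mem_univ w) (Set.mem_univ z) (div_nonneg hp h.le)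
        (div_nonneg hq h.le) (by field_simp)
      simp only [smul_eq_mul] at h1
      have h2 := mul_le_mul_of_nonneg_left hω (div_nonneg hp h.le)
      linarith
    · rw [smul_add, smul_smul, smul_smul, mul_div_cancel₀ _ h.ne', mul_div_cancel₀ _ h.ne']
    · field_simp

/-! ### ARBCD: the main sequence as a convex combination of the proximal points. -/

section ARBCD

variable {V : Type*} [Fintype V] [DecidableEq V] {n : ℕ}

/-- The assumptions under which ARBCD is analysed: convex nonnegative `gᵢ`, and a convex `f`
whose block gradients satisfy the descent inequality with constants `Lip i`. -/
structure IsCompositeProblem (g : V → EuclideanSpace ℝ (Fin n) → ℝ) (f : Blocks V n → ℝ)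
    (Lip : V → ℝ) : Prop where
  convex : ∀ i, ConvexOn ℝ Set.univ (g i)
  nonneg : ∀ i x, 0 ≤ g i x
  lip_pos : ∀ i, 0 < Lip i
  linear_le : ∀ x w, f x + ∑ i, inner ℝ (blockGrad f i x) (w i - x i) ≤ f w
  descent : ∀ x i d, f (Function.update x i (x i + d)) ≤
    f x + inner ℝ (blockGrad f i x) d + Lip i / 2 * ‖d‖ ^ 2

variable (g : V → EuclideanSpace ℝ (Fin n) → ℝ) (f : Blocks V n → ℝ) (Lip : V → ℝ)
  (z0 : Blocks V n) (idx : ℕ → V)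

theorem arbcdState_t (ℓ : ℕ) :
    (arbcdState g f Lip z0 idx ℓ).t = stepSize (Fintype.card V) ℓ := by
  induction ℓ with
  | zero => rfl
  | succ ℓ ih => simp only [arbcdState, arbcdStep, stepSize, ih]

variable {idx} in
theorem arbcdState_congr {idx' : ℕ → V} {ℓ : ℕ} (h : ∀ m < ℓ, idx m = idx' m) :
    arbcdState g f Lip z0 idx ℓ = arbcdState g f Lip z0 idx' ℓ := by
  induction ℓ with
  | zero => rfl
  | succ ℓ ih =>
    simp only [arbcdState]
    rw [ih fun m hm => h m (by omega), h ℓ (by omega)]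

variable {idx} in
theorem arbcdOutput_congr {idx' : ℕ → V} {T : ℕ} (h : ∀ m < T + 1, idx m = idx' m) :
    arbcdOutput g f Lip z0 idx T = arbcdOutput g f Lip z0 idx' T := by
  simp only [arbcdOutput]
  rw [arbcdState_congr g f Lip z0 h,
    arbcdState_congr g f Lip z0 fun m hm => h m (Nat.lt_succ_of_lt hm)]

/-- The main sequence of ARBCD: `x^(0) = z^(0)`, and `x^(ℓ+1)` is the output after `ℓ + 1`
iterations. -/
noncomputable def mainSeq : ℕ → Blocks V n
  | 0 => z0
  | ℓ + 1 => arbcdOutput g f Lip z0 idx ℓ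

/-- The convex combination of the values `∑ᵢ gᵢ(zᵢ^(m))`, `m ≤ ℓ`, with the weights that
express `x^(ℓ)` through the `z^(m)`. -/
noncomputable def averagedCost : ℕ → ℝ
  | 0 => ∑ i, g i (z0 i)
  | ℓ + 1 =>
    (1 - 1 / (Fintype.card V * stepSize (Fintype.card V) ℓ)) * averagedCost ℓ
      - (Fintype.card V - 1) * (1 / (Fintype.card V * stepSize (Fintype.card V) ℓ)) *
        ∑ i, g i ((arbcdState g f Lip z0 idx ℓ).z i)
      + 1 / stepSize (Fintype.card V) ℓ * ∑ i, g i ((arbcdState g f Lip z0 idx (ℓ + 1)).z i)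

variable {idx} in
theorem mainSeq_congr {idx' : ℕ → V} {ℓ : ℕ} (h : ∀ m < ℓ, idx m = idx' m) :
    mainSeq g f Lip z0 idx ℓ = mainSeq g f Lip z0 idx' ℓ := by
  cases ℓ with
  | zero => rfl
  | succ ℓ => exact arbcdOutput_congr g f Lip z0 h

variable {idx} in
theorem averagedCost_congr {idx' : ℕ → V} {ℓ : ℕ} (h : ∀ m < ℓ, idx m = idx' m) :
    averagedCost g f Lip z0 idx ℓ = averagedCost g f Lip z0 idx' ℓ := by
  induction ℓ with
  | zero => rfl
  | succ ℓ ih =>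
    simp only [averagedCost]
    rw [ih fun m hm => h m (by omega), arbcdState_congr g f Lip z0 h,
      arbcdState_congr g f Lip z0 fun m hm => h m (Nat.lt_succ_of_lt hm)]

/-- The point at which ARBCD evaluates the gradient is a convex combination of `x` and `z`. -/
theorem extrapolate_eq [Nonempty V] (ℓ : ℕ) :
    extrapolate (stepSize (Fintype.card V) ℓ) (arbcdState g f Lip z0 idx ℓ).u
      (arbcdState g f Lip z0 idx ℓ).z =
    (1 - 1 / (Fintype.card V * stepSize (Fintype.card V) ℓ)) • mainSeq g f Lip z0 idx ℓ +
      (1 / (Fintype.card V * stepSize (Fintype.card V) ℓ) : ℝ) •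
        (arbcdState g f Lip z0 idx ℓ).z := by
  have hN : (0 : ℝ) < Fintype.card V := by exact_mod_cast Fintype.card_pos
  cases ℓ with
  | zero => simp [extrapolate, arbcdState, mainSeq, ← add_smul]
  | succ ℓ =>
    simp only [mainSeq, arbcdOutput, arbcdState_t, extrapolate]
    have h := stepSize_succ_sq hN ℓ
    have h1 := one_le_stepSize hN ℓ
    have h2 := one_le_stepSize hN (ℓ + 1)
    set t := stepSize (Fintype.card V) ℓ
    set t' := stepSize (Fintype.card V) (ℓ + 1)
    -- This is the step-size recursion in disguise, and the reason why `u` can be carried over to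
    -- the next step size without rescaling.
    have key : (1 / (Fintype.card V * t')) ^ 2
        = (1 - 1 / (Fintype.card V * t')) * (1 / (Fintype.card V * t)) ^ 2 := by
      have ht : 0 < t := by linarith
      have ht' : 0 < t' := by linarith
      field_simp at h ⊢
      linear_combination -h
    rw [key]
    module

/-- The coefficient N²t(1-t) in the update of `u` is chosen so that the increment of z enters with
total weight (1/t - 1) + 1 = 1/t. -/
theorem mainSeq_succ [Nonempty V] (ℓ : ℕ) :
    let y := extrapolate (stepSize (Fintype.card V) ℓ) (arbcdState g f Lip z0 idx ℓ).u
      (arbcdState g f Lip z0 idx ℓ).z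
    mainSeq g f Lip z0 idx (ℓ + 1) = y + (1 / stepSize (Fintype.card V) ℓ) •
      ((arbcdState g f Lip z0 idx (ℓ + 1)).z - (arbcdState g f Lip z0 idx ℓ).z) := by
  have hN : (0 : ℝ) < Fintype.card V := by exact_mod_cast Fintype.card_pos
  have h1 := one_le_stepSize hN ℓ
  simp only [mainSeq, arbcdOutput, arbcdState_t, extrapolate]
  funext j
  simp only [arbcdState, arbcdStep, arbcdState_t, Pi.add_apply, Pi.smul_apply, Pi.sub_apply]
  set t := stepSize (Fintype.card V) ℓ
  have ht : 0 < t := by linarith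
  by_cases hj : j = idx ℓ
  · subst hj
    simp only [Function.update_self]
    have key : (1 / (Fintype.card V * t)) ^ 2 * ((Fintype.card V : ℝ) ^ 2 * t * (1 - t))
        = 1 / t - 1 := by
      field_simp
    rw [smul_add, smul_smul, key]
    module
  · simp only [Function.update_of_ne hj]
    module

/-- Jensen's inequality, once the weights of the z's in the main sequence are known to be
nonnegative. This is not evident, since the recursion subtracts (N-1)/(Nt) from the weight of the
current z. -/
theorem averagedCost_ge [Nonempty V] (hg : ∀ i, ConvexOn ℝ Set.univ (g i)) (ℓ : ℕ) :
    ∑ i, g i (mainSeq g f Lip z0 idx ℓ i) ≤ averagedCost g f Lip z0 idx ℓ := by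
  have hN : (1 : ℝ) ≤ Fintype.card V := by exact_mod_cast Fintype.card_pos
  have hN0 : (0 : ℝ) < Fintype.card V := by linarith
  set ψ : Blocks V n → ℝ := fun x => ∑ i, g i (x i) with hψdef
  have hψ : ConvexOn ℝ Set.univ ψ := convexOn_sum_blocks hg
  -- β is the weight of the newest z; all older points are lumped into w, with cost at most ω. The
  -- lower bound on (Nt - 1)β is exactly what keeps the weight in `hq` nonnegative at the next step.
  have inv : ∃ (β : ℝ) (w : Blocks V n) (ω : ℝ), 0 ≤ β ∧ β ≤ 1 ∧
      (Fintype.card V : ℝ) - 1 ≤ (Fintype.card V * stepSize (Fintype.card V) ℓ - 1) * β ∧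
      ψ w ≤ ω ∧
      mainSeq g f Lip z0 idx ℓ = (1 - β) • w + β • (arbcdState g f Lip z0 idx ℓ).z ∧
      averagedCost g f Lip z0 idx ℓ
        = (1 - β) * ω + β * ψ (arbcdState g f Lip z0 idx ℓ).z := by
    induction ℓ with
    | zero =>
      exact ⟨1, z0, ψ z0, zero_le_one, le_rfl, by simp [stepSize], le_rfl,
        by simp [mainSeq, arbcdState], by simp [averagedCost, arbcdState, hψdef]⟩
    | succ ℓ ih =>
      obtain ⟨β, w, ω, hβ0, hβ1, hβ, hω, hx, hΨ⟩ := ih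
      have ht := one_le_stepSize hN0 ℓ
      have ht' := stepSize_succ_ge hN0 ℓ
      have hx' := mainSeq_succ g f Lip z0 idx ℓ
      simp only [extrapolate_eq, hx] at hx'
      set t := stepSize (Fintype.card V) ℓ with htdef
      set N := (Fintype.card V : ℝ) with hNdef
      have htp : 0 < t := by linarith
      have hNt : 1 ≤ N * t := by nlinarith
      have hp : 0 ≤ (1 - 1 / (N * t)) * (1 - β) :=
        mul_nonneg (by rw [sub_nonneg, div_le_one (by positivity)]; exact hNt) (by linarith)
      have hq : 0 ≤ (1 - 1 / (N * t)) * β - (N - 1) * (1 / (N * t)) := by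
        have : (1 - 1 / (N * t)) * β - (N - 1) * (1 / (N * t))
            = ((N * t - 1) * β - (N - 1)) / (N * t) := by field_simp
        rw [this]
        exact div_nonneg (by linarith) (by positivity)
      obtain ⟨w', ω', hω', hw1, hw2⟩ := exists_combination hψ w
        (arbcdState g f Lip z0 idx ℓ).z hω hp hq
      have hpq : (1 - 1 / (N * t)) * (1 - β) + ((1 - 1 / (N * t)) * β - (N - 1) * (1 / (N * t)))
          = 1 - 1 / t := by field_simp; ring
      rw [hpq] at hw1 hw2
      -- The newest z enters with weight 1/t, so the bound to propagate reads (N-1)t ≤ Nt' - 1 with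
      -- t' the next step size; it holds since 1 ≤ t ≤ t'.
      refine ⟨1 / t, w', ω', by positivity, by rw [div_le_one htp]; exact ht, ?_, hω', ?_, ?_⟩
      · rw [mul_one_div, le_div_iff₀ htp]
        have : 0 ≤ 1 / (2 * N) := by positivity
        nlinarith
      · rw [hx', ← hw1]
        have : (1 : ℝ) / t = N * (1 / (N * t)) := by field_simp
        rw [this]
        module
      · rw [← hw2, averagedCost, hΨ, ← htdef, ← hNdef]
        ring
  obtain ⟨β, w, ω, hβ0, hβ1, -, hω, hx, hΨ⟩ := inv
  rw [hΨ, hx]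
  have h1 := hψ.2 (Set.mem_univ w) (Set.mem_univ (arbcdState g f Lip z0 idx ℓ).z)
    (by linarith : 0 ≤ 1 - β) hβ0 (by ring)
  simp only [smul_eq_mul] at h1
  have h2 := mul_le_mul_of_nonneg_left hω (by linarith : 0 ≤ 1 - β)
  exact h1.trans (by linarith)

end ARBCD

end AsyncDFAL

/-! ### ARBCD: the Lyapunov function and the 1/T² rate. -/

namespace AsyncDFAL

section ARBCDRate

variable {V : Type*} [Fintype V] [DecidableEq V] {n : ℕ}

/-- The proximal inequality for one block step, multiplied by `l / t`. -/
theorem block_prox_inequality {g : EuclideanSpace ℝ (Fin n) → ℝ} (hg : ConvexOn ℝ Set.univ g)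
    (hg0 : ∀ x, 0 ≤ g x) {t l : ℝ} (ht : 0 < t) (hl : 0 < l)
    (z G w : EuclideanSpace ℝ (Fin n)) :
    let z' := prox (fun y => t / l * g y) (z - (t / l) • G)
    t * g z' + t * inner ℝ G (z' - z) + l / 2 * ‖z' - z‖ ^ 2 + l / 2 * ‖z' - w‖ ^ 2
      ≤ t * g w + t * inner ℝ G (w - z) + l / 2 * ‖z - w‖ ^ 2 := by
  intro z'
  have hs : 0 ≤ t / l := by positivity
  have h := prox_three_point (hg.smul hs) (fun x => smul_nonneg hs (hg0 x)) (z - (t / l) • G) w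
  simp only [smul_eq_mul] at h
  change t / l * g z' + 1 / 2 * ‖z' - (z - (t / l) • G)‖ ^ 2 + 1 / 2 * ‖w - z'‖ ^ 2
    ≤ _ at h
  have e : ∀ v : EuclideanSpace ℝ (Fin n), ‖v - (z - (t / l) • G)‖ ^ 2
      = ‖v - z‖ ^ 2 + 2 * (t / l * inner ℝ G (v - z)) + ‖(t / l) • G‖ ^ 2 := by
    intro v
    have : v - (z - (t / l) • G) = (v - z) + (t / l) • G := by abel
    rw [this, norm_add_sq_real, inner_smul_right, real_inner_comm]
  rw [e, e, norm_sub_rev w z', norm_sub_rev w z] at h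
  have h2 := mul_le_mul_of_nonneg_left h hl.le
  have e1 : ∀ a : ℝ, l * (t / l * a) = t * a := fun a => by field_simp
  have e2 := e1 (inner ℝ G (z' - z))
  have e3 := e1 (inner ℝ G (w - z))
  have e4 := e1 (g z')
  have e5 := e1 (g w)
  linarith

/-- The quantity whose mean decreases along ARBCD, for a comparison point `w`. -/
noncomputable def lyapunov (g : V → EuclideanSpace ℝ (Fin n) → ℝ) (f : Blocks V n → ℝ) (Lip : V → ℝ)
    (z0 w : Blocks V n) (idx : ℕ → V) (ℓ : ℕ) : ℝ :=
  (stepSize (Fintype.card V) ℓ ^ 2 - stepSize (Fintype.card V) ℓ / Fintype.card V) *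
    (f (mainSeq g f Lip z0 idx ℓ) + averagedCost g f Lip z0 idx ℓ
      - (f w + ∑ i, g i (w i))) +
    ∑ i, Lip i / 2 * ‖(arbcdState g f Lip z0 idx ℓ).z i - w i‖ ^ 2

variable {g : V → EuclideanSpace ℝ (Fin n) → ℝ} {f : Blocks V n → ℝ} {Lip : V → ℝ}

theorem lyapunov_congr (z0 w : Blocks V n) {idx idx' : ℕ → V} {ℓ : ℕ}
    (h : ∀ m < ℓ, idx m = idx' m) :
    lyapunov g f Lip z0 w idx ℓ = lyapunov g f Lip z0 w idx' ℓ := by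
  simp only [lyapunov]
  rw [mainSeq_congr g f Lip z0 h, averagedCost_congr g f Lip z0 h, arbcdState_congr g f Lip z0 h]

theorem sum_update_apply {β : Type*} (h : V → β → ℝ) (z : V → β) (i : V) (b : β) :
    ∑ j, h j (Function.update z i b j) = ∑ j, h j (z j) + (h i b - h i (z i)) := by
  rw [← Finset.add_sum_erase _ _ (Finset.mem_univ i),
    ← Finset.add_sum_erase (Finset.univ) (fun j => h j (z j)) (Finset.mem_univ i)]
  have : ∑ j ∈ Finset.univ.erase i, h j (Function.update z i b j)
      = ∑ j ∈ Finset.univ.erase i, h j (z j) :=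
    Finset.sum_congr rfl fun j hj => by rw [Function.update_of_ne (Finset.ne_of_mem_erase hj)]
  rw [this, Function.update_self]
  ring

/-- The supermartingale property, with the mean over the drawn node written as a sum over all nodes.
For each node the descent inequality at y is combined with the proximal inequality; summing over
nodes assembles the block inner products into a full one, to which convexity of f applies. -/
theorem sum_lyapunov_succ_le [Nonempty V] (hP : IsCompositeProblem g f Lip)
    (z0 w : Blocks V n) (idx : ℕ → V) (ℓ : ℕ) :
    ∑ i, lyapunov g f Lip z0 w (Function.update idx ℓ i) (ℓ + 1)
      ≤ Fintype.card V * lyapunov g f Lip z0 w idx ℓ := by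
  have hN1 : (1 : ℝ) ≤ Fintype.card V := by exact_mod_cast Fintype.card_pos
  have hN0 : (0 : ℝ) < Fintype.card V := by linarith
  have ht1 := one_le_stepSize hN0 ℓ
  set N := (Fintype.card V : ℝ) with hNdef
  set t := stepSize N ℓ with htdef
  have ht : 0 < t := by linarith
  set z := (arbcdState g f Lip z0 idx ℓ).z with hz
  set x := mainSeq g f Lip z0 idx ℓ with hx
  set Ψ := averagedCost g f Lip z0 idx ℓ with hΨ
  set y := extrapolate t (arbcdState g f Lip z0 idx ℓ).u z with hy
  have hyx : y = (1 - 1 / (N * t)) • x + (1 / (N * t)) • z := extrapolate_eq g f Lip z0 idx ℓ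
  let z' : V → EuclideanSpace ℝ (Fin n) := fun i =>
    prox (fun v => t / Lip i * g i v) (z i - (t / Lip i) • blockGrad f i y)
  have hagree : ∀ i, ∀ m < ℓ, Function.update idx ℓ i m = idx m := fun i m hm =>
    Function.update_of_ne hm.ne _ _
  have hstate : ∀ i, arbcdState g f Lip z0 (Function.update idx ℓ i) ℓ
      = arbcdState g f Lip z0 idx ℓ := fun i => arbcdState_congr g f Lip z0 (hagree i)
  have hzi : ∀ i, (arbcdState g f Lip z0 (Function.update idx ℓ i) (ℓ + 1)).z
      = Function.update z i (z' i) := by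
    intro i
    simp only [arbcdState, arbcdStep, hstate, Function.update_self, arbcdState_t]
    rfl
  have hxi : ∀ i, mainSeq g f Lip z0 (Function.update idx ℓ i) (ℓ + 1)
      = Function.update y i (y i + (1 / t) • (z' i - z i)) := by
    intro i
    have h := mainSeq_succ g f Lip z0 (Function.update idx ℓ i) ℓ
    rw [hzi, hstate] at h
    rw [h]
    funext j
    by_cases hj : j = i
    · subst hj
      simp [← hz, ← hNdef, ← htdef, ← hy]
    · simp [Function.update_of_ne hj, ← hz, ← hNdef, ← htdef, ← hy]
  -- The averaged cost is affine in the single new value gᵢ(z'ᵢ). The true cost at the main point is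
  -- not, which is why the Lyapunov function contains the average.
  have hΨi : ∀ i, averagedCost g f Lip z0 (Function.update idx ℓ i) (ℓ + 1)
      = (1 - 1 / (N * t)) * Ψ + 1 / (N * t) * ∑ j, g j (z j)
        + 1 / t * (g i (z' i) - g i (z i)) := by
    intro i
    rw [averagedCost, averagedCost_congr g f Lip z0 (hagree i), hstate, hzi,
      sum_update_apply g z i (z' i)]
    simp only [← hNdef, ← htdef, ← hz, ← hΨ]
    field_simp
    ring
  -- The block moves by (z' - z)/t, so the descent inequality at y times t² has exactly the linear
  -- and quadratic terms of the proximal inequality.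
  have hWi : ∀ i, lyapunov g f Lip z0 w (Function.update idx ℓ i) (ℓ + 1)
      ≤ (t ^ 2 * (f y + (1 - 1 / (N * t)) * Ψ + 1 / (N * t) * ∑ j, g j (z j)
            - (f w + ∑ j, g j (w j)))
          + ∑ j, Lip j / 2 * ‖z j - w j‖ ^ 2)
        + (t * g i (z' i) + t * inner ℝ (blockGrad f i y) (z' i - z i)
            + Lip i / 2 * ‖z' i - z i‖ ^ 2 + Lip i / 2 * ‖z' i - w i‖ ^ 2)
        - t * g i (z i) - Lip i / 2 * ‖z i - w i‖ ^ 2 := by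
    intro i
    have hd := hP.descent y i ((1 / t) • (z' i - z i))
    rw [inner_smul_right, norm_smul, Real.norm_of_nonneg (by positivity)] at hd
    rw [lyapunov, ← hNdef, stepSize_succ_sq hN0, ← htdef, hxi, hΨi, hzi,
      sum_update_apply (fun j v => Lip j / 2 * ‖v - w j‖ ^ 2) z i (z' i)]
    have hd' := mul_le_mul_of_nonneg_left hd (sq_nonneg t)
    have e1 : t ^ 2 * (f y + 1 / t * inner ℝ (blockGrad f i y) (z' i - z i) +
        Lip i / 2 * (1 / t * ‖z' i - z i‖) ^ 2) = t ^ 2 * f y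
        + t * inner ℝ (blockGrad f i y) (z' i - z i) + Lip i / 2 * ‖z' i - z i‖ ^ 2 := by
      field_simp
    have e2 : t ^ 2 * (1 / t * (g i (z' i) - g i (z i))) = t * (g i (z' i) - g i (z i)) := by
      field_simp
    rw [e1] at hd'
    linarith
  have hprox : ∀ i, _ := fun i =>
    block_prox_inequality (hP.convex i) (hP.nonneg i) ht (hP.lip_pos i) (z i) (blockGrad f i y) (w i)
  have hsum : ∑ i, lyapunov g f Lip z0 w (Function.update idx ℓ i) (ℓ + 1)
      ≤ ∑ i, ((t ^ 2 * (f y + (1 - 1 / (N * t)) * Ψ + 1 / (N * t) * ∑ j, g j (z j)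
            - (f w + ∑ j, g j (w j)))
          + ∑ j, Lip j / 2 * ‖z j - w j‖ ^ 2)
        + (t * g i (w i) + t * inner ℝ (blockGrad f i y) (w i - z i)) - t * g i (z i)) :=
    Finset.sum_le_sum fun i _ => (hWi i).trans (by have := hprox i; linarith)
  refine hsum.trans ?_
  simp only [Finset.sum_sub_distrib, Finset.sum_add_distrib, Finset.sum_const, Finset.card_univ,
    nsmul_eq_mul, ← hNdef, ← Finset.mul_sum]
  have hfw := hP.linear_le y w
  have hfx := hP.linear_le y x
  -- Since Nt y = (Nt - 1)x + z, one has w - z = (w - y) + (Nt - 1)(x - y); linearization of f at y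
  -- is then used at both w and x.
  have hinner : ∑ i, inner ℝ (blockGrad f i y) (w i - z i)
      = ∑ i, inner ℝ (blockGrad f i y) (w i - y i)
        + (N * t - 1) * ∑ i, inner ℝ (blockGrad f i y) (x i - y i) := by
    rw [Finset.mul_sum, ← Finset.sum_add_distrib]
    refine Finset.sum_congr rfl fun i _ => ?_
    rw [← inner_smul_right, ← inner_add_right]
    congr 1
    have hyi : y i = (1 - 1 / (N * t)) • x i + (1 / (N * t)) • z i := congrFun hyx i
    have h1 : (N * t) • y i = (N * t - 1) • x i + z i := by
      rw [hyi, smul_add, smul_smul, smul_smul]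
      have e1 : N * t * (1 - 1 / (N * t)) = N * t - 1 := by field_simp
      have e2 : N * t * (1 / (N * t)) = 1 := by field_simp
      rw [e1, e2, one_smul]
    have h2 : z i = (N * t) • y i - (N * t - 1) • x i := by rw [h1]; abel
    rw [h2]
    module
  have hNt : 1 ≤ N * t := by nlinarith
  have hfx' := mul_le_mul_of_nonneg_left hfx (by linarith : 0 ≤ N * t - 1)
  have hin : ∑ i, inner ℝ (blockGrad f i y) (w i - z i)
      ≤ f w + (N * t - 1) * f x - N * t * f y := by
    rw [hinner]; linarith
  have hin' := mul_le_mul_of_nonneg_left hin ht.le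
  rw [lyapunov, ← hNdef, ← htdef, ← hz, ← hx, ← hΨ]
  have e1 : N * (t ^ 2 * (f y + (1 - 1 / (N * t)) * Ψ + 1 / (N * t) * ∑ j, g j (z j)
        - (f w + ∑ j, g j (w j)))) = N * t ^ 2 * f y + (N * t ^ 2 - t) * Ψ + t * ∑ j, g j (z j)
        - N * t ^ 2 * (f w + ∑ j, g j (w j)) := by
    field_simp
  have e2 : N * ((t ^ 2 - t / N) * (f x + Ψ - (f w + ∑ i, g i (w i))))
      = (N * t ^ 2 - t) * (f x + Ψ - (f w + ∑ i, g i (w i))) := by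
    field_simp
  rw [e1, mul_add N, e2]
  nlinarith

/-- Extension of a finite sequence of nodes to an infinite one. -/
noncomputable def extendSeq [Nonempty V] {m : ℕ} (h : Fin m → V) (ℓ : ℕ) : V :=
  if hl : ℓ < m then h ⟨ℓ, hl⟩ else Classical.arbitrary V

/-- Uniform counting over all node sequences of length m plays the role of the expectation; the last
draw is split off by `Fin.snoc`. The choice of `idx` is immaterial, because no draw has been made at
time 0. -/
theorem sum_lyapunov_le [Nonempty V] (hP : IsCompositeProblem g f Lip)
    (z0 w : Blocks V n) (idx : ℕ → V) (m : ℕ) :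
    ∑ h : Fin m → V, lyapunov g f Lip z0 w (extendSeq h) m
      ≤ (Fintype.card V : ℝ) ^ m * lyapunov g f Lip z0 w idx 0 := by
  induction m with
  | zero =>
    rw [Fintype.sum_unique, pow_zero, one_mul]
    exact (lyapunov_congr z0 w (by simp)).le
  | succ m ih =>
    rw [← (Fin.snocEquiv fun _ : Fin (m + 1) => V).sum_comp, Fintype.sum_prod_type_right]
    have h1 : ∀ h : Fin m → V,
        ∑ i, lyapunov g f Lip z0 w (extendSeq (Fin.snocEquiv (fun _ => V) (i, h))) (m + 1)
        ≤ Fintype.card V * lyapunov g f Lip z0 w (extendSeq h) m := by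
      intro h
      refine le_trans (le_of_eq (Finset.sum_congr rfl fun i _ => ?_))
        (sum_lyapunov_succ_le hP z0 w (extendSeq h) m)
      refine lyapunov_congr z0 w fun l hl => ?_
      rcases Nat.lt_succ_iff_lt_or_eq.1 hl with hlt | rfl
      · rw [Function.update_of_ne hlt.ne]
        simp only [extendSeq, hl, hlt, dif_pos, Fin.snocEquiv_apply]
        exact Fin.snoc_castSucc (α := fun _ => V) i h ⟨l, hlt⟩
      · rw [Function.update_self]
        simp only [extendSeq, hl, dif_pos, Fin.snocEquiv_apply]
        exact Fin.snoc_last (α := fun _ => V) i h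
    refine (Finset.sum_le_sum fun h _ => h1 h).trans ?_
    rw [← Finset.mul_sum, pow_succ', mul_assoc]
    exact mul_le_mul_of_nonneg_left ih (by positivity)

/-- The `O(1/T²)` rate of ARBCD, averaged over all sequences of drawn nodes. -/
theorem sum_arbcdOutput_le [Nonempty V] (hP : IsCompositeProblem g f Lip)
    (z0 w : Blocks V n) (T : ℕ) :
    ∑ h : Fin (T + 1) → V, stepSize (Fintype.card V) T ^ 2 *
      (∑ i, g i (arbcdOutput g f Lip z0 (extendSeq h) T i)
          + f (arbcdOutput g f Lip z0 (extendSeq h) T) - (∑ i, g i (w i) + f w))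
      ≤ (Fintype.card V : ℝ) ^ (T + 1) *
        ((1 - 1 / Fintype.card V) * (∑ i, g i (z0 i) + f z0 - (∑ i, g i (w i) + f w))
          + ∑ i, Lip i / 2 * ‖z0 i - w i‖ ^ 2) := by
  have hN0 : (0 : ℝ) < Fintype.card V := by exact_mod_cast Fintype.card_pos
  have h := sum_lyapunov_le hP z0 w (fun _ => Classical.arbitrary V) (T + 1)
  have h0 : lyapunov g f Lip z0 w (fun _ => Classical.arbitrary V) 0
      = (1 - 1 / Fintype.card V) * (∑ i, g i (z0 i) + f z0 - (∑ i, g i (w i) + f w))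
          + ∑ i, Lip i / 2 * ‖z0 i - w i‖ ^ 2 := by
    simp only [lyapunov, stepSize, mainSeq, averagedCost, arbcdState]
    ring
  rw [h0] at h
  refine (Finset.sum_le_sum fun s _ => ?_).trans h
  rw [lyapunov, stepSize_succ_sq hN0]
  have h1 := averagedCost_ge g f Lip z0 (extendSeq s) hP.convex (T + 1)
  have h2 : 0 ≤ ∑ i, Lip i / 2 *
      ‖(arbcdState g f Lip z0 (extendSeq s) (T + 1)).z i - w i‖ ^ 2 :=
    Finset.sum_nonneg fun i _ => mul_nonneg (by linarith [hP.lip_pos i]) (sq_nonneg _)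
  rw [mainSeq] at h1 ⊢
  have h3 := mul_le_mul_of_nonneg_left h1 (sq_nonneg (stepSize (Fintype.card V) T))
  linarith

open Classical in
/-- At most half of the sequences of drawn nodes lead ARBCD to an output that is not
`α`-optimal, if the number of iterations is large enough. -/
theorem card_not_optimal_le [Nonempty V] (hP : IsCompositeProblem g f Lip)
    {z0 w : Blocks V n} {T : ℕ} {α : ℝ} (hα : 0 < α)
    (hw : ∀ x : Blocks V n, ∑ i, g i (w i) + f w ≤ ∑ i, g i (x i) + f x)
    (hT : 2 * ((∑ i, g i (z0 i) + f z0 - (∑ i, g i (w i) + f w))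
          + ∑ i, Lip i / 2 * ‖z0 i - w i‖ ^ 2) ≤ stepSize (Fintype.card V) T ^ 2 * α) :
    2 * ((Finset.univ.filter fun h : Fin (T + 1) → V =>
      α < ∑ i, g i (arbcdOutput g f Lip z0 (extendSeq h) T i)
          + f (arbcdOutput g f Lip z0 (extendSeq h) T) - (∑ i, g i (w i) + f w)).card : ℝ)
      ≤ (Fintype.card V : ℝ) ^ (T + 1) := by
  have hN1 : (1 : ℝ) ≤ Fintype.card V := by exact_mod_cast Fintype.card_pos
  have hN0 : (0 : ℝ) < Fintype.card V := by linarith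
  have ht := one_le_stepSize hN0 T
  set t := stepSize (Fintype.card V) T with htdef
  set Δ : (Fin (T + 1) → V) → ℝ := fun h => ∑ i, g i (arbcdOutput g f Lip z0 (extendSeq h) T i)
          + f (arbcdOutput g f Lip z0 (extendSeq h) T) - (∑ i, g i (w i) + f w) with hΔ
  have hrate := sum_arbcdOutput_le hP z0 w T
  have hΔ0 : ∀ h, 0 ≤ Δ h := fun h => sub_nonneg.2 (hw _)
  have hz0 := sub_nonneg.2 (hw z0)
  -- Markov's inequality for the counting measure; it needs the gaps Δ to be nonnegative, hence a
  -- minimizer w.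
  have h1 : ((Finset.univ.filter fun h => α < Δ h).card : ℝ) * (t ^ 2 * α)
      ≤ ∑ h, t ^ 2 * Δ h := by
    rw [← nsmul_eq_mul, ← Finset.sum_const]
    refine (Finset.sum_le_sum fun h hh => ?_).trans
      (Finset.sum_le_sum_of_subset_of_nonneg (Finset.filter_subset _ _) fun h _ _ =>
        mul_nonneg (sq_nonneg t) (hΔ0 h))
    exact mul_le_mul_of_nonneg_left (Finset.mem_filter.1 hh).2.le (sq_nonneg t)
  have h2 : (1 - 1 / (Fintype.card V : ℝ)) * (∑ i, g i (z0 i) + f z0 - (∑ i, g i (w i) + f w))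
      ≤ ∑ i, g i (z0 i) + f z0 - (∑ i, g i (w i) + f w) := by
    have : 0 ≤ 1 / (Fintype.card V : ℝ) := by positivity
    nlinarith
  have hpow : (0 : ℝ) < (Fintype.card V : ℝ) ^ (T + 1) := by positivity
  have h3 : ((Finset.univ.filter fun h => α < Δ h).card : ℝ) * (t ^ 2 * α)
      ≤ (Fintype.card V : ℝ) ^ (T + 1) * (t ^ 2 * α / 2) :=
    (h1.trans hrate).trans (mul_le_mul_of_nonneg_left (by linarith) hpow.le)
  have hpos : 0 < t ^ 2 * α := by positivity
  have h4 : (2 * ((Finset.univ.filter fun h => α < Δ h).card : ℝ)) * (t ^ 2 * α)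
      ≤ (Fintype.card V : ℝ) ^ (T + 1) * (t ^ 2 * α) := by linarith
  exact le_of_mul_le_mul_right h4 hpos

end ARBCDRate

end AsyncDFAL

/-! ### The constraint matrix, the graph Laplacian and the smooth part. -/

namespace AsyncDFAL

namespace Data

section Operator

variable {V κ : Type*} [Fintype V] [DecidableEq V] [Fintype κ] {n : ℕ}

/-- The map `x ↦ A x` as a linear map. -/
def mulAₗ (D : Data V κ n) : Blocks V n →ₗ[ℝ] EuclideanSpace ℝ κ where
  toFun := D.mulA
  map_add' x y := by
    ext s
    simp [mulA, Matrix.mulVec, dotProduct, mul_add, Finset.sum_add_distrib]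
  map_smul' a x := by
    ext s
    simp [mulA, Matrix.mulVec, dotProduct, Finset.mul_sum, mul_left_comm]

theorem mulA_add (D : Data V κ n) (x y : Blocks V n) : D.mulA (x + y) = D.mulA x + D.mulA y :=
  D.mulAₗ.map_add x y

theorem mulA_sub (D : Data V κ n) (x y : Blocks V n) : D.mulA (x - y) = D.mulA x - D.mulA y :=
  D.mulAₗ.map_sub x y

theorem continuous_mulA (D : Data V κ n) : Continuous D.mulA :=
  D.mulAₗ.continuous_of_finiteDimensional

/-- The blocks of `Aᵀ r`. -/
def adjA (D : Data V κ n) : EuclideanSpace ℝ κ →ₗ[ℝ] Blocks V n where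
  toFun r i := WithLp.toLp 2 fun l => ∑ s, D.A s (i, l) * r s
  map_add' r r' := by
    ext i l
    simp [mul_add, Finset.sum_add_distrib]
  map_smul' a r := by
    ext i l
    simp [Finset.mul_sum, mul_left_comm]

theorem inner_mulA (D : Data V κ n) (r : EuclideanSpace ℝ κ) (x : Blocks V n) :
    inner ℝ r (D.mulA x) = ∑ i, inner ℝ (D.adjA r i) (x i) := by
  simp only [mulA, adjA, PiLp.inner_apply, Matrix.mulVec, dotProduct, RCLike.inner_apply,
    conj_trivial, LinearMap.coe_mk, AddHom.coe_mk]
  simp only [Fintype.sum_prod_type, Finset.mul_sum, Finset.sum_mul]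
  rw [Finset.sum_comm]
  refine Finset.sum_congr rfl fun i _ => ?_
  rw [Finset.sum_comm]
  refine Finset.sum_congr rfl fun l _ => Finset.sum_congr rfl fun s _ => ?_
  ring

/-- The Kronecker factor 1 decouples the n coordinates, each of which contributes the quadratic form
of the Laplacian. The sum is over ordered pairs, whence the division by 2. -/
theorem norm_mulA_sq (G : SimpleGraph V) [DecidableRel G.Adj] (D : Data V κ n)
    (hA : D.Aᵀ * D.A = G.lapMatrix ℝ ⊗ₖ (1 : Matrix (Fin n) (Fin n) ℝ)) (x : Blocks V n) :
    ‖D.mulA x‖ ^ 2 = (∑ i, ∑ j, if G.Adj i j then ‖x i - x j‖ ^ 2 else 0) / 2 := by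
  have h1 : ‖D.mulA x‖ ^ 2 = ∑ l : Fin n, (fun i => x i l) ⬝ᵥ (G.lapMatrix ℝ *ᵥ fun i => x i l) := by
    have : ‖D.mulA x‖ ^ 2
        = (fun q : V × Fin n => x q.1 q.2) ⬝ᵥ ((D.Aᵀ * D.A) *ᵥ fun q => x q.1 q.2) := by
      rw [← Matrix.mulVec_mulVec, Matrix.dotProduct_mulVec, Matrix.vecMul_transpose,
        EuclideanSpace.real_norm_sq_eq]
      simp [mulA, dotProduct, sq]
    rw [this, hA]
    simp only [dotProduct, Matrix.mulVec, Matrix.kroneckerMap_apply, Fintype.sum_prod_type,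
      Matrix.one_apply, mul_ite, mul_one, mul_zero, ite_mul, zero_mul, Finset.sum_ite_eq,
      Finset.mem_univ, if_true]
    rw [Finset.sum_comm]
  rw [h1]
  have h2 : ∀ l : Fin n, (fun i => x i l) ⬝ᵥ (G.lapMatrix ℝ *ᵥ fun i => x i l)
      = (∑ i, ∑ j, if G.Adj i j then (x i l - x j l) ^ 2 else 0) / 2 := by
    intro l
    rw [← G.lapMatrix_toLinearMap₂' ℝ, Matrix.toLinearMap₂'_apply']
  simp only [h2, ← Finset.sum_div]
  congr 1
  rw [Finset.sum_comm]
  refine Finset.sum_congr rfl fun i _ => ?_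
  rw [Finset.sum_comm]
  refine Finset.sum_congr rfl fun j _ => ?_
  split_ifs
  · rw [EuclideanSpace.real_norm_sq_eq]
    simp
  · simp

variable {G : SimpleGraph V} [DecidableRel G.Adj] {D : Data V κ n}

/-- The curvature of ½‖A x‖² along block i is the degree of i: this is the dᵢ in the step constants.
-/
theorem norm_mulA_single_sq
    (hA : D.Aᵀ * D.A = G.lapMatrix ℝ ⊗ₖ (1 : Matrix (Fin n) (Fin n) ℝ)) (i : V)
    (d : EuclideanSpace ℝ (Fin n)) : ‖D.mulA (Pi.single i d)‖ ^ 2 = G.degree i * ‖d‖ ^ 2 := by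
  rw [norm_mulA_sq G D hA]
  have hd : ∀ k, (∑ j, if G.Adj k j then (1 : ℝ) else 0) = G.degree k := fun k =>
    (G.degree_eq_sum_if_adj k).symm
  have h : ∀ k j : V, (if G.Adj k j then ‖(Pi.single i d : Blocks V n) k
        - (Pi.single i d : Blocks V n) j‖ ^ 2 else 0)
      = (if k = i then (if G.Adj i j then ‖d‖ ^ 2 else 0) else 0)
        + (if j = i then (if G.Adj i k then ‖d‖ ^ 2 else 0) else 0) := by
    intro k j
    by_cases hk : k = i
    · subst hk
      by_cases hj : j = k
      · subst hj; simp
      · simp [hj]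
    · by_cases hj : j = i
      · subst hj; simp [hk, G.adj_comm]
      · simp [hk, hj]
  simp only [h, Finset.sum_add_distrib, Finset.sum_ite_irrel, Finset.sum_const_zero,
    Finset.sum_ite_eq', Finset.mem_univ, if_true]
  have h2 : (∑ j, if G.Adj i j then ‖d‖ ^ 2 else 0) = G.degree i * ‖d‖ ^ 2 := by
    rw [← hd, Finset.sum_mul]
    exact Finset.sum_congr rfl fun j _ => by split_ifs <;> simp
  rw [h2]
  ring

theorem norm_sub_le_norm_mulA
    (hA : D.Aᵀ * D.A = G.lapMatrix ℝ ⊗ₖ (1 : Matrix (Fin n) (Fin n) ℝ)) (x : Blocks V n)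
    {i j : V} (hij : G.Adj i j) : ‖x i - x j‖ ≤ ‖D.mulA x‖ := by
  refine le_of_sq_le_sq ?_ (norm_nonneg _)
  rw [norm_mulA_sq G D hA, le_div_iff₀ two_pos]
  have hne : i ≠ j := hij.ne
  have hnn : ∀ k l : V, 0 ≤ if G.Adj k l then ‖x k - x l‖ ^ 2 else 0 := fun k l => by
    split_ifs <;> positivity
  have hrow : ∀ {k l : V}, G.Adj k l →
      ‖x k - x l‖ ^ 2 ≤ ∑ l, if G.Adj k l then ‖x k - x l‖ ^ 2 else 0 := by
    intro k l hkl
    have := Finset.single_le_sum (fun l _ => hnn k l) (Finset.mem_univ l)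
    simpa [hkl] using this
  -- Both orientations of the edge are kept, which offsets the factor 1/2.
  have h := Finset.add_le_sum (f := fun k => ∑ l, if G.Adj k l then ‖x k - x l‖ ^ 2 else 0)
    (fun k _ => Finset.sum_nonneg fun l _ => hnn k l)
    (Finset.mem_univ i) (Finset.mem_univ j) hne
  have h1 := hrow hij
  have h2 := hrow hij.symm
  rw [norm_sub_rev (x j)] at h2
  linarith

/-- Telescoping along a path, which has fewer edges than the graph has nodes. -/
theorem norm_sub_le_card_mul (hG : G.Connected)
    (hA : D.Aᵀ * D.A = G.lapMatrix ℝ ⊗ₖ (1 : Matrix (Fin n) (Fin n) ℝ)) (x : Blocks V n)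
    (i j : V) : ‖x i - x j‖ ≤ Fintype.card V * ‖D.mulA x‖ := by
  have hwalk : ∀ {i j : V} (p : G.Walk i j), ‖x i - x j‖ ≤ p.length * ‖D.mulA x‖ := by
    intro i j p
    induction p with
    | nil => simp
    | @cons u v w hadj p ih =>
      have h1 := norm_sub_le_norm_mulA hA x hadj
      have h2 := norm_sub_le_norm_sub_add_norm_sub (x u) (x v) (x w)
      refine h2.trans ((add_le_add h1 ih).trans_eq ?_)
      rw [SimpleGraph.Walk.length_cons]
      push_cast
      ring
  obtain ⟨p, hp⟩ := (hG.preconnected i j).exists_isPath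
  refine (hwalk p).trans (mul_le_mul_of_nonneg_right ?_ (norm_nonneg _))
  exact_mod_cast hp.length_lt.le

/-- On the range of `A` the norm is controlled by the blocks of `Aᵀ θ`. -/
theorem exists_norm_le_of_mem_range (D : Data V κ n) :
    ∃ C : ℝ, 0 ≤ C ∧ ∀ θ ∈ LinearMap.range D.mulAₗ, ∀ b : ℝ, 0 ≤ b →
      (∀ i, ‖D.adjA θ i‖ ≤ b) → ‖θ‖ ≤ C * b := by
  let f : LinearMap.range D.mulAₗ →ₗ[ℝ] Blocks V n := D.adjA.comp (Submodule.subtype _)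
  -- If AᵀAw = 0 then ‖Aw‖² = 0. An injective linear map in finite dimension is antilipschitz, which
  -- supplies the constant.
  have hker : LinearMap.ker f = ⊥ := by
    rw [LinearMap.ker_eq_bot']
    rintro ⟨θ, w, rfl⟩ h
    have h0 : D.adjA (D.mulA w) = 0 := h
    have h1 := D.inner_mulA (D.mulA w) w
    rw [h0] at h1
    simp only [Pi.zero_apply, inner_zero_left, Finset.sum_const_zero] at h1
    exact Subtype.ext (inner_self_eq_zero.1 h1)
  obtain ⟨K, -, hK⟩ := f.exists_antilipschitzWith hker
  refine ⟨K, K.2, fun θ hθ b hb h => ?_⟩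
  have h1 : ‖θ‖ ≤ K * ‖D.adjA θ‖ := by
    have := hK.le_mul_dist ⟨θ, hθ⟩ 0
    rwa [map_zero, dist_zero_right, dist_zero_right] at this
  exact h1.trans (mul_le_mul_of_nonneg_left ((pi_norm_le_iff_of_nonneg hb).2 h) K.2)

end Operator

section SmoothPart

variable {V κ : Type*} [Fintype V] [DecidableEq V] [Fintype κ] {n : ℕ}
  {G : SimpleGraph V} [DecidableRel G.Adj] {D : Data V κ n}

/-- The exact change of the smooth part under a change of one block. -/
theorem smoothPart_update
    (hA : D.Aᵀ * D.A = G.lapMatrix ℝ ⊗ₖ (1 : Matrix (Fin n) (Fin n) ℝ)) (k : ℕ)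
    (θ : EuclideanSpace ℝ κ) (x : Blocks V n) (i : V) (y : EuclideanSpace ℝ (Fin n)) :
    D.smoothPart k θ (Function.update x i y) = D.smoothPart k θ x
      + D.lam k * (D.γ i y - D.γ i (x i))
      + inner ℝ (D.adjA (D.mulA x - D.lam k • θ) i) (y - x i)
      + G.degree i / 2 * ‖y - x i‖ ^ 2 := by
  have hupd : Function.update x i y = x + Pi.single i (y - x i) := by
    funext j
    by_cases hj : j = i
    · subst hj; simp
    · simp [hj]
  have hγ : ∑ j, D.γ j (Function.update x i y j)
      = ∑ j, D.γ j (x j) + (D.γ i y - D.γ i (x i)) := sum_update_apply D.γ x i y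
  rw [smoothPart, hγ, hupd, mulA_add, add_sub_right_comm, norm_add_sq_real,
    norm_mulA_single_sq hA, inner_mulA]
  have hin : ∑ j, inner ℝ (D.adjA (D.mulA x - D.lam k • θ) j)
      ((Pi.single i (y - x i) : Blocks V n) j)
      = inner ℝ (D.adjA (D.mulA x - D.lam k • θ) i) (y - x i) := by
    rw [Finset.sum_eq_single i]
    · simp
    · intro j _ hj; simp [hj]
    · simp
  rw [hin, smoothPart]
  ring

theorem blockGrad_smoothPart
    (hA : D.Aᵀ * D.A = G.lapMatrix ℝ ⊗ₖ (1 : Matrix (Fin n) (Fin n) ℝ))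
    (hd : ∀ i, Differentiable ℝ (D.γ i)) (k : ℕ) (θ : EuclideanSpace ℝ κ) (i : V)
    (x : Blocks V n) :
    blockGrad (D.smoothPart k θ) i x
      = D.lam k • gradient (D.γ i) (x i) + D.adjA (D.mulA x - D.lam k • θ) i := by
  refine HasGradientAt.gradient ?_
  rw [hasGradientAt_iff_hasFDerivAt]
  simp only [smoothPart_update hA]
  set a := D.adjA (D.mulA x - D.lam k • θ) i
  have h1 : HasFDerivAt (fun y => D.smoothPart k θ x + D.lam k * (D.γ i y - D.γ i (x i)))
      (D.lam k • fderiv ℝ (D.γ i) (x i)) (x i) :=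
    (((hd i (x i)).hasFDerivAt.sub_const _).const_mul _).const_add _
  have h2 : HasFDerivAt (fun y => inner ℝ a (y - x i)) (innerSL ℝ a) (x i) :=
    (innerSL ℝ a).hasFDerivAt.comp (x i) ((hasFDerivAt_id (x i)).sub_const (x i))
  have h3 : HasFDerivAt (fun y => (G.degree i : ℝ) / 2 * ‖y - x i‖ ^ 2)
      (0 : EuclideanSpace ℝ (Fin n) →L[ℝ] ℝ) (x i) := by
    have := (((hasFDerivAt_id (x i)).sub_const (x i)).norm_sq).const_mul ((G.degree i : ℝ) / 2)
    simpa using this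
  have hdual : InnerProductSpace.toDual ℝ _ (D.lam k • gradient (D.γ i) (x i) + a)
      = D.lam k • fderiv ℝ (D.γ i) (x i) + innerSL ℝ a + 0 := by
    ext v
    simp
  rw [hdual]
  exact (h1.add h2).add h3

end SmoothPart

end Data

end AsyncDFAL

/-! ### What an accepted iterate satisfies. -/

namespace AsyncDFAL

namespace Data

variable {V κ : Type*} [Fintype V] [DecidableEq V] [Fintype κ] {n : ℕ}

/-- The standing assumptions on the problem and on the parameters of DFAL. -/
structure IsAdmissible (D : Data V κ n) (G : SimpleGraph V) [DecidableRel G.Adj]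
    (L : V → ℝ≥0) (τ : V → ℝ) : Prop where
  connected : G.Connected
  smooth : ∀ i, IsSmoothTerm (D.γ i) (L i)
  nonsmooth : ∀ i, IsNonsmoothTerm (D.ρ i) (τ i)
  gram : D.Aᵀ * D.A = G.lapMatrix ℝ ⊗ₖ (1 : Matrix (Fin n) (Fin n) ℝ)
  c_pos : 0 < D.c
  c_lt_one : D.c < 1
  lam_pos : 0 < D.lam₁
  alpha_pos : 0 < D.alpha₁
  xi_pos : 0 < D.xi₁
  xi_div_lam_lt : ∀ i, D.xi₁ / D.lam₁ < τ i

/-- A common consequence of conditions (a) and (b). -/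
def NearMin (D : Data V κ n) (k : ℕ) (θ : EuclideanSpace ℝ κ) (x : Blocks V n) : Prop :=
  ∀ w, D.subproblem k θ x ≤
    D.subproblem k θ w + D.alpha k + D.xi k * ∑ i, ‖x i - w i‖

variable {G : SimpleGraph V} [DecidableRel G.Adj] {D : Data V κ n} {L : V → ℝ≥0} {τ : V → ℝ}

namespace IsAdmissible

theorem lam_k_pos (hD : D.IsAdmissible G L τ) (k : ℕ) : 0 < D.lam k :=
  mul_pos hD.lam_pos (pow_pos hD.c_pos k)

theorem alpha_k_pos (hD : D.IsAdmissible G L τ) (k : ℕ) : 0 < D.alpha k :=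
  mul_pos hD.alpha_pos (pow_pos (pow_pos hD.c_pos 2) k)

theorem xi_k_pos (hD : D.IsAdmissible G L τ) (k : ℕ) : 0 < D.xi k :=
  mul_pos hD.xi_pos (pow_pos (pow_pos hD.c_pos 2) k)

theorem pow_le_one (hD : D.IsAdmissible G L τ) (k : ℕ) : D.c ^ k ≤ 1 :=
  pow_le_one₀ hD.c_pos.le hD.c_lt_one.le

theorem lam_le (hD : D.IsAdmissible G L τ) (k : ℕ) : D.lam k ≤ D.lam₁ :=
  mul_le_of_le_one_right hD.lam_pos.le (hD.pow_le_one k)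

/-- After division by λ the tolerances are still O(c^k); `xi_eq` is the analogue for ξ. The
convergence rate rests on this. -/
theorem alpha_eq (hD : D.IsAdmissible G L τ) (k : ℕ) :
    D.alpha k = D.lam k * (D.alpha₁ / D.lam₁ * D.c ^ k) := by
  have := hD.lam_pos.ne'
  rw [alpha, lam, ← pow_mul, mul_comm 2 k, pow_mul]
  field_simp

theorem xi_eq (hD : D.IsAdmissible G L τ) (k : ℕ) :
    D.xi k = D.lam k * (D.xi₁ / D.lam₁ * D.c ^ k) := by
  have := hD.lam_pos.ne'
  rw [xi, lam, ← pow_mul, mul_comm 2 k, pow_mul]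
  field_simp

theorem blockGrad_eq (hD : D.IsAdmissible G L τ) (k : ℕ) (θ : EuclideanSpace ℝ κ) (i : V)
    (x : Blocks V n) :
    blockGrad (D.smoothPart k θ) i x
      = D.lam k • gradient (D.γ i) (x i) + D.adjA (D.mulA x - D.lam k • θ) i :=
  blockGrad_smoothPart hD.gram (fun i => (hD.smooth i).differentiable) k θ i x

theorem smoothPart_linear_le (hD : D.IsAdmissible G L τ) (k : ℕ) (θ : EuclideanSpace ℝ κ)
    (x w : Blocks V n) :
    D.smoothPart k θ x + ∑ i, inner ℝ (blockGrad (D.smoothPart k θ) i x) (w i - x i)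
      ≤ D.smoothPart k θ w := by
  simp only [hD.blockGrad_eq, inner_add_left, inner_smul_left, conj_trivial,
    Finset.sum_add_distrib, ← Finset.mul_sum]
  have h1 : ∑ i, D.γ i (x i) + ∑ i, inner ℝ (gradient (D.γ i) (x i)) (w i - x i)
      ≤ ∑ i, D.γ i (w i) := by
    rw [← Finset.sum_add_distrib]
    exact Finset.sum_le_sum fun i _ =>
      gradient_mem_subdiff (hD.smooth i).convex (hD.smooth i).differentiable (x i) (w i)
  have h2 := D.inner_mulA (D.mulA x - D.lam k • θ) (w - x)
  simp only [Pi.sub_apply] at h2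
  rw [← h2]
  have h3 : D.mulA w - D.lam k • θ = (D.mulA x - D.lam k • θ) + D.mulA (w - x) := by
    rw [mulA_sub]; abel
  simp only [smoothPart]
  rw [h3, norm_add_sq_real]
  have h4 := mul_le_mul_of_nonneg_left h1 (hD.lam_k_pos k).le
  nlinarith [sq_nonneg ‖D.mulA (w - x)‖]

theorem smoothPart_descent (hD : D.IsAdmissible G L τ) (k : ℕ) (θ : EuclideanSpace ℝ κ)
    (x : Blocks V n) (i : V) (d : EuclideanSpace ℝ (Fin n)) :
    D.smoothPart k θ (Function.update x i (x i + d)) ≤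
      D.smoothPart k θ x + inner ℝ (blockGrad (D.smoothPart k θ) i x) d
        + (D.lam k * L i + G.degree i) / 2 * ‖d‖ ^ 2 := by
  rw [smoothPart_update hD.gram, hD.blockGrad_eq, inner_add_left, inner_smul_left, conj_trivial,
    add_sub_cancel_left]
  have h := descent_lemma (hD.smooth i).differentiable (hD.smooth i).lipschitz (x i) d
  have h2 := mul_le_mul_of_nonneg_left h (hD.lam_k_pos k).le
  linarith

theorem nonempty (hD : D.IsAdmissible G L τ) : Nonempty V := hD.connected.nonempty

theorem lip_pos [Nontrivial V] (hD : D.IsAdmissible G L τ) (k : ℕ) (i : V) :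
    0 < D.lam k * L i + G.degree i := by
  have h1 : 0 < G.degree i := hD.connected.preconnected.degree_pos_of_nontrivial i
  have h2 : 0 ≤ D.lam k * L i := mul_nonneg (hD.lam_k_pos k).le (L i).2
  have h3 : (0 : ℝ) < G.degree i := by exact_mod_cast h1
  linarith

theorem rho_nonneg (hD : D.IsAdmissible G L τ) (i : V) (x : EuclideanSpace ℝ (Fin n)) :
    0 ≤ D.ρ i x :=
  (mul_nonneg (hD.nonsmooth i).tau_pos.le (norm_nonneg x)).trans ((hD.nonsmooth i).coercive x)

theorem isCompositeProblem [Nontrivial V] (hD : D.IsAdmissible G L τ) (k : ℕ)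
    (θ : EuclideanSpace ℝ κ) :
    IsCompositeProblem (fun i y => D.lam k * D.ρ i y) (D.smoothPart k θ)
      (fun i => D.lam k * L i + G.degree i) where
  convex i := (hD.nonsmooth i).convex.smul (hD.lam_k_pos k).le
  nonneg i x := mul_nonneg (hD.lam_k_pos k).le (hD.rho_nonneg i x)
  lip_pos := hD.lip_pos k
  linear_le := hD.smoothPart_linear_le k θ
  descent := hD.smoothPart_descent k θ

theorem nearMin_of_isMinOn (hD : D.IsAdmissible G L τ) {k : ℕ} {θ : EuclideanSpace ℝ κ}
    {x xs : Blocks V n} (hxs : IsMinOn (D.subproblem k θ) Set.univ xs)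
    (h : D.subproblem k θ x - D.subproblem k θ xs ≤ D.alpha k) : D.NearMin k θ x := by
  intro w
  have h1 : D.subproblem k θ xs ≤ D.subproblem k θ w := hxs (Set.mem_univ w)
  have h2 : 0 ≤ D.xi k * ∑ i, ‖x i - w i‖ :=
    mul_nonneg (hD.xi_k_pos k).le (Finset.sum_nonneg fun i _ => norm_nonneg _)
  linarith

/-- The subgradient inequalities for the ρᵢ and the smooth part add up to P(w) ≥ P(x) + ∑⟨gᵢ, wᵢ -
xᵢ⟩. Only ‖gᵢ‖ ≤ ξ is used, the factor 1/√N being at most 1. -/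
theorem nearMin_of_condB (hD : D.IsAdmissible G L τ) {k : ℕ} {θ : EuclideanSpace ℝ κ}
    {x : Blocks V n} (h : D.CondB k θ x) : D.NearMin k θ x := by
  obtain ⟨g, hg, hgn⟩ := h
  choose q hq hgq using hg
  intro w
  have hα := (hD.alpha_k_pos k).le
  have hne := hD.nonempty
  have hN : 1 ≤ √(Fintype.card V : ℝ) := Real.one_le_sqrt.2 (by exact_mod_cast Fintype.card_pos)
  have hgn' : ∀ i, ‖g i‖ ≤ D.xi k := fun i =>
    (hgn i).trans (div_le_self (hD.xi_k_pos k).le hN)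
  have h1 := hD.smoothPart_linear_le k θ x w
  have h2 : ∑ i, (D.lam k * D.ρ i (x i) + D.lam k * inner ℝ (q i) (w i - x i))
      ≤ ∑ i, D.lam k * D.ρ i (w i) := by
    refine Finset.sum_le_sum fun i _ => ?_
    rw [← mul_add]
    exact mul_le_mul_of_nonneg_left (hq i (w i)) (hD.lam_k_pos k).le
  have h3 : ∑ i, (D.lam k * inner ℝ (q i) (w i - x i)
      + inner ℝ (blockGrad (D.smoothPart k θ) i x) (w i - x i))
      = ∑ i, inner ℝ (g i) (w i - x i) := by
    refine Finset.sum_congr rfl fun i _ => ?_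
    rw [hgq, inner_add_left, inner_smul_left, conj_trivial]
  have h4 : ∑ i, -inner ℝ (g i) (w i - x i) ≤ ∑ i, D.xi k * ‖x i - w i‖ := by
    refine Finset.sum_le_sum fun i _ => ?_
    refine (neg_le_abs _).trans ((abs_real_inner_le_norm _ _).trans ?_)
    rw [norm_sub_rev]
    exact mul_le_mul_of_nonneg_right (hgn' i) (norm_nonneg _)
  rw [Finset.sum_add_distrib] at h2 h3
  rw [Finset.sum_neg_distrib] at h4
  simp only [subproblem, Finset.mul_sum] at *
  linarith

theorem nearMin_of_accepted (hD : D.IsAdmissible G L τ) {x : ℕ → Blocks V n} {k : ℕ}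
    (h : D.Accepted x k) : D.NearMin k (D.dual x k) (x (k + 1)) := by
  rcases h with ⟨xs, hxs, h⟩ | h
  · exact hD.nearMin_of_isMinOn hxs h
  · exact hD.nearMin_of_condB h

/-- The block gradients of the smooth part at an accepted point are of order `λ`. -/
theorem exists_norm_gradient_sub_adjA_le (hD : D.IsAdmissible G L τ) :
    ∃ b : ℝ, 0 ≤ b ∧ ∀ k θ x, D.NearMin k θ x → ∀ i,
      ‖gradient (D.γ i) (x i) - D.adjA (θ - (D.lam k)⁻¹ • D.mulA x) i‖ ≤ b := by
  choose B hB0 hB using fun i => (hD.nonsmooth i).subdiff_bounded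
  have hlam := hD.lam_pos
  have hα := hD.alpha_pos
  have hξ := hD.xi_pos
  let e : V → ℝ := fun i => D.alpha₁ / D.lam₁ + B i + D.xi₁ / D.lam₁
    + (D.lam₁ * L i + G.degree i) / (2 * D.lam₁)
  have he : ∀ i, 0 ≤ e i := fun i => by have := hB0 i; positivity
  refine ⟨∑ i, e i, Finset.sum_nonneg fun i _ => he i, fun k θ x hx i => ?_⟩
  refine le_trans ?_ (Finset.single_le_sum (fun j _ => he j) (Finset.mem_univ i))
  have hlk := hD.lam_k_pos k
  have hck := pow_pos hD.c_pos k
  have hc1 := hD.pow_le_one k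
  set g := blockGrad (D.smoothPart k θ) i x with hgdef
  -- The vector θ - λ⁻¹A x is the next dual vector, so a bound ‖g‖ = O(λ) ties its image under Aᵀ to
  -- ∇γᵢ.
  have hg : g = D.lam k • (gradient (D.γ i) (x i) - D.adjA (θ - (D.lam k)⁻¹ • D.mulA x) i) := by
    rw [hgdef, hD.blockGrad_eq, smul_sub, ← Pi.smul_apply (D.lam k) (D.adjA _), ← map_smul,
      smul_sub, smul_inv_smul₀ hlk.ne', ← neg_sub (D.lam k • θ), map_neg, Pi.neg_apply,
      ← sub_eq_add_neg]
  have hkey : ‖g‖ ≤ D.alpha k / D.c ^ k + (D.lam k * B i + D.xi k)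
      + (D.lam k * L i + G.degree i) / 2 * D.c ^ k := by
    -- A test step of length c^k balances the errors: α/c^k and the curvature term times c^k are
    -- both O(λ).
    refine norm_le_of_forall_inner_ge hck (hD.alpha_k_pos k).le
      (add_nonneg (mul_nonneg hlk.le (hB0 i).le) (hD.xi_k_pos k).le) (by positivity) fun d => ?_
    have h1 := hx (Function.update x i (x i + d))
    have h2 := hD.smoothPart_descent k θ x i d
    have h3 : ∑ j, D.ρ j (Function.update x i (x i + d) j)
        = ∑ j, D.ρ j (x j) + (D.ρ i (x i + d) - D.ρ i (x i)) := sum_update_apply D.ρ x i _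
    have h4 : ∑ j, ‖x j - Function.update x i (x i + d) j‖ = ‖d‖ := by
      rw [sum_update_apply (fun j v => ‖x j - v‖) x i]
      simp
    have h5 := sub_le_of_subdiff_bounded (hD.nonsmooth i).convex (hB i) (x i + d) (x i)
    rw [add_sub_cancel_left] at h5
    simp only [subproblem, h3, h4] at h1
    have h6 := mul_le_mul_of_nonneg_left h5 hlk.le
    linarith
  rw [hg, norm_smul, Real.norm_of_nonneg hlk.le] at hkey
  refine le_of_mul_le_mul_left (hkey.trans ?_) hlk
  have e1 : D.alpha k / D.c ^ k = D.lam k * (D.alpha₁ / D.lam₁) := by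
    rw [hD.alpha_eq]; field_simp
  have e2 : D.xi k ≤ D.lam k * (D.xi₁ / D.lam₁) := by
    rw [hD.xi_eq]
    exact mul_le_mul_of_nonneg_left (mul_le_of_le_one_right (by positivity) hc1) hlk.le
  have e3 : (D.lam k * L i + G.degree i) / 2 * D.c ^ k
      ≤ D.lam k * ((D.lam₁ * L i + G.degree i) / (2 * D.lam₁)) := by
    have : D.lam k * ((D.lam₁ * L i + G.degree i) / (2 * D.lam₁))
        = (D.lam₁ * L i + G.degree i) / 2 * D.c ^ k := by
      rw [lam]; field_simp
    rw [this]
    exact mul_le_mul_of_nonneg_right (by gcongr; exact hD.lam_le k) hck.le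
  simp only [e]
  linarith

/-- The bound for the iterates and for the smooth terms in terms of the dual vector. -/
theorem exists_sum_le (hD : D.IsAdmissible G L τ) :
    ∃ δ C : ℝ, ∃ m : V → ℝ, 0 < δ ∧ 0 ≤ C ∧ (∀ i y, m i ≤ D.γ i y) ∧
      ∀ k θ x, D.NearMin k θ x →
      δ * ∑ i, ‖x i‖ + ∑ i, (D.γ i (x i) - m i) ≤ C + D.lam k / 2 * ‖θ‖ ^ 2 := by
  have hne := hD.nonempty
  choose m hm using fun i => (hD.smooth i).bddBelow
  obtain ⟨i₀, hi₀⟩ := Finite.exists_min τ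
  have hlam := hD.lam_pos
  have hα := hD.alpha_pos
  have hξ := hD.xi_pos
  refine ⟨τ i₀ - D.xi₁ / D.lam₁, ∑ i, (D.ρ i 0 + (D.γ i 0 - m i)) + D.alpha₁ / D.lam₁, m,
    sub_pos.2 (hD.xi_div_lam_lt i₀), ?_, hm, fun k θ x hx => ?_⟩
  · have h1 : 0 ≤ ∑ i, (D.ρ i 0 + (D.γ i 0 - m i)) := Finset.sum_nonneg fun i _ =>
      add_nonneg (hD.rho_nonneg i 0) (sub_nonneg.2 (hm i 0))
    positivity
  have hlk := hD.lam_k_pos k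
  have hc1 := hD.pow_le_one k
  -- At 0 the quadratic penalty is ½λ²‖θ‖², and the error ξ∑‖xᵢ‖ is absorbed by the growth of the ρᵢ
  -- because ξ₁/λ₁ < τᵢ.
  have h1 := hx 0
  have h0 : D.mulA (0 : Blocks V n) = 0 := D.mulAₗ.map_zero
  simp only [subproblem, smoothPart, h0, zero_sub, norm_neg, norm_smul, Pi.zero_apply, sub_zero,
    Real.norm_of_nonneg hlk.le] at h1
  have hs : 0 ≤ ∑ i, ‖x i‖ := Finset.sum_nonneg fun i _ => norm_nonneg _
  have h2 : D.alpha k ≤ D.lam k * (D.alpha₁ / D.lam₁) := by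
    rw [hD.alpha_eq]
    exact mul_le_mul_of_nonneg_left (mul_le_of_le_one_right (by positivity) hc1) hlk.le
  have h3 : D.xi k * ∑ i, ‖x i‖ ≤ D.lam k * (D.xi₁ / D.lam₁ * ∑ i, ‖x i‖) := by
    rw [hD.xi_eq, mul_assoc]
    refine mul_le_mul_of_nonneg_left (mul_le_mul_of_nonneg_right ?_ hs) hlk.le
    exact mul_le_of_le_one_right (by positivity) hc1
  have h4 : τ i₀ * ∑ i, ‖x i‖ ≤ ∑ i, D.ρ i (x i) := by
    rw [Finset.mul_sum]
    exact Finset.sum_le_sum fun i _ =>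
      (mul_le_mul_of_nonneg_right (hi₀ i) (norm_nonneg _)).trans ((hD.nonsmooth i).coercive _)
  have h5 := sq_nonneg ‖D.mulA x - D.lam k • θ‖
  have h6 : D.lam k * (∑ i, D.ρ i (x i) + ∑ i, D.γ i (x i)) ≤ D.lam k *
      (∑ i, D.ρ i 0 + ∑ i, D.γ i 0 + D.lam k / 2 * ‖θ‖ ^ 2 + D.alpha₁ / D.lam₁
        + D.xi₁ / D.lam₁ * ∑ i, ‖x i‖) := by
    linarith
  have h7 := le_of_mul_le_mul_left h6 hlk
  simp only [Finset.sum_sub_distrib, Finset.sum_add_distrib]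
  linarith

end IsAdmissible

end Data

end AsyncDFAL

/-! ### Boundedness of the dual vectors and the O(c^k) rate. -/

namespace AsyncDFAL

/-- A sequence with `u (k+1) ≤ a + b r^k u k`, `0 < r < 1`, is bounded by a constant that depends
only on `a`, `b` and `r`. -/
theorem exists_bound_of_recursion {a b r : ℝ} (ha : 0 ≤ a) (hb : 0 ≤ b) (hr0 : 0 < r)
    (hr1 : r < 1) : ∃ U : ℝ, 0 ≤ U ∧ ∀ (u : ℕ → ℝ) (k : ℕ), u 0 = 0 →
      (∀ j < k, u (j + 1) ≤ a + b * r ^ j * u j) → u k ≤ U := by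
  -- The extremal sequence, with equality in the recursion. Once b r^k < 1/2 the bound 2a + S
  -- reproduces itself, S being the sum of the finitely many earlier terms.
  let w : ℕ → ℝ := fun k => Nat.rec 0 (fun j wj => a + b * r ^ j * wj) k
  have hw : ∀ j, w (j + 1) = a + b * r ^ j * w j := fun j => rfl
  have hw0 : ∀ j, 0 ≤ w j := by
    intro j
    induction j with
    | zero => exact le_rfl
    | succ j ih => rw [hw]; positivity
  have hlim : Filter.Tendsto (fun k : ℕ => b * r ^ k) Filter.atTop (nhds (b * 0)) :=
    (tendsto_pow_atTop_nhds_zero_of_lt_one hr0.le hr1).const_mul b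
  rw [mul_zero] at hlim
  obtain ⟨K, hK⟩ := Filter.eventually_atTop.1
    (hlim.eventually_lt_const (by norm_num : (0 : ℝ) < 1 / 2))
  have hsum : ∀ j ≤ K, w j ≤ ∑ l ∈ Finset.range (K + 1), w l := fun j hj =>
    Finset.single_le_sum (fun l _ => hw0 l) (Finset.mem_range.2 (Nat.lt_succ_of_le hj))
  have hS0 : 0 ≤ ∑ l ∈ Finset.range (K + 1), w l := Finset.sum_nonneg fun l _ => hw0 l
  set S := ∑ l ∈ Finset.range (K + 1), w l
  have hwU : ∀ j, w j ≤ 2 * a + S := by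
    intro j
    induction j with
    | zero => exact add_nonneg (by linarith) hS0
    | succ j ih =>
      rcases le_or_gt (j + 1) K with h | h
      · exact (hsum _ h).trans (by linarith)
      · have h1 := hK j (by omega)
        have h2 : b * r ^ j * w j ≤ 1 / 2 * w j := mul_le_mul_of_nonneg_right h1.le (hw0 j)
        rw [hw]
        linarith
  refine ⟨2 * a + S, by linarith, fun u k hu0 hu => le_trans ?_ (hwU k)⟩
  induction k with
  | zero => exact hu0.le
  | succ k ih =>
    have h1 := ih fun j hj => hu j (by omega)
    refine (hu k (Nat.lt_succ_self k)).trans ?_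
    rw [hw]
    have : 0 ≤ b * r ^ k := by positivity
    have := mul_le_mul_of_nonneg_left h1 this
    linarith

namespace Data

variable {V κ : Type*} [Fintype V] [DecidableEq V] [Fintype κ] {n : ℕ}
  {G : SimpleGraph V} [DecidableRel G.Adj] {D : Data V κ n} {L : V → ℝ≥0} {τ : V → ℝ}

theorem dual_mem_range (D : Data V κ n) (x : ℕ → Blocks V n) (k : ℕ) :
    D.dual x k ∈ LinearMap.range D.mulAₗ := by
  induction k with
  | zero => exact Submodule.zero_mem _
  | succ k ih => exact Submodule.sub_mem _ ih (Submodule.smul_mem _ _ ⟨x (k + 1), rfl⟩)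

namespace IsAdmissible

/-- The gradients ∇γᵢ control Aᵀ of the next dual vector up to a constant, and are themselves
controlled by the square root of C + λ‖θ‖²/2. Dual vectors lie in the range of A, so this is a
recursion for their norms with factor O(√λ). -/
theorem exists_dual_bound (hD : D.IsAdmissible G L τ) :
    ∃ U : ℝ, 0 ≤ U ∧ ∀ (x : ℕ → Blocks V n) (k : ℕ),
      (∀ j < k, D.NearMin j (D.dual x j) (x (j + 1))) → ‖D.dual x k‖ ≤ U := by
  obtain ⟨b, hb0, hb⟩ := hD.exists_norm_gradient_sub_adjA_le
  obtain ⟨δ, C, m, hδ, hC, hm, hsum⟩ := hD.exists_sum_le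
  obtain ⟨R, hR0, hR⟩ := D.exists_norm_le_of_mem_range
  set Λ : ℝ := ∑ i, ((L i : ℝ) + 1) with hΛdef
  have hΛ0 : 0 ≤ Λ := Finset.sum_nonneg fun i _ => by positivity
  have hΛ : ∀ i, (L i : ℝ) + 1 ≤ Λ := fun i =>
    Finset.single_le_sum (f := fun i => (L i : ℝ) + 1) (fun j _ => by positivity)
      (Finset.mem_univ i)
  -- The ratio is √c because λ, of order c^j, enters through the bound on the squared gradient.
  obtain ⟨U, hU0, hU⟩ := exists_bound_of_recursion (a := R * (√(2 * Λ * C) + b))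
    (b := R * √(Λ * D.lam₁)) (r := √D.c) (by positivity) (by positivity)
    (Real.sqrt_pos.2 hD.c_pos) ((Real.sqrt_lt' one_pos).2 (by simpa using hD.c_lt_one))
  refine ⟨U, hU0, fun x k hx => hU (fun k => ‖D.dual x k‖) k (by simp [dual]) fun j hj => ?_⟩
  have hgrad : ∀ i, ‖gradient (D.γ i) (x (j + 1) i)‖
      ≤ √(2 * Λ * C) + √(Λ * D.lam₁) * √D.c ^ j * ‖D.dual x j‖ := by
    intro i
    refine le_of_sq_le_sq ?_ (by positivity)
    have h1 := norm_gradient_sq_le (hD.smooth i).differentiable (hD.smooth i).lipschitz (hm i)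
      (x (j + 1) i)
    have h2 := hsum j _ _ (hx j hj)
    have h3 : 0 ≤ δ * ∑ i, ‖x (j + 1) i‖ :=
      mul_nonneg hδ.le (Finset.sum_nonneg fun i _ => norm_nonneg _)
    have h4 : D.γ i (x (j + 1) i) - m i ≤ ∑ i, (D.γ i (x (j + 1) i) - m i) :=
      Finset.single_le_sum (f := fun i => D.γ i (x (j + 1) i) - m i)
        (fun l _ => sub_nonneg.2 (hm l _)) (Finset.mem_univ i)
    have h5 : 2 * ((L i : ℝ) + 1) * (D.γ i (x (j + 1) i) - m i)
        ≤ 2 * Λ * (C + D.lam j / 2 * ‖D.dual x j‖ ^ 2) :=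
      mul_le_mul (by linarith [hΛ i]) (by linarith) (sub_nonneg.2 (hm i _)) (by linarith)
    have h6 : √(2 * Λ * C) ^ 2 = 2 * Λ * C := Real.sq_sqrt (by positivity)
    have h7 : (√(Λ * D.lam₁) * √D.c ^ j * ‖D.dual x j‖) ^ 2
        = Λ * D.lam j * ‖D.dual x j‖ ^ 2 := by
      rw [mul_pow, mul_pow, Real.sq_sqrt (mul_nonneg hΛ0 hD.lam_pos.le), ← pow_mul, mul_comm j,
        pow_mul, Real.sq_sqrt hD.c_pos.le, lam]
      ring
    have h8 : 0 ≤ √(2 * Λ * C) * (√(Λ * D.lam₁) * √D.c ^ j * ‖D.dual x j‖) := by positivity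
    rw [add_sq, h6, h7]
    linarith
  have hadj : ∀ i, ‖D.adjA (D.dual x (j + 1)) i‖
      ≤ √(2 * Λ * C) + √(Λ * D.lam₁) * √D.c ^ j * ‖D.dual x j‖ + b := by
    intro i
    have h1 := hb j _ _ (hx j hj) i
    have h2 := norm_sub_norm_le (D.adjA (D.dual x (j + 1)) i) (gradient (D.γ i) (x (j + 1) i))
    rw [norm_sub_rev] at h2
    have h3 : D.dual x (j + 1) = D.dual x j - (D.lam j)⁻¹ • D.mulA (x (j + 1)) := rfl
    rw [← h3] at h1
    linarith [hgrad i]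
  have h := hR _ (D.dual_mem_range x (j + 1)) _ (by positivity) hadj
  change ‖D.dual x (j + 1)‖ ≤ _
  refine h.trans (le_of_eq ?_)
  ring

theorem exists_iterate_bound (hD : D.IsAdmissible G L τ) {U : ℝ} :
    ∃ R : ℝ, 0 ≤ R ∧ ∀ k θ x, ‖θ‖ ≤ U → D.NearMin k θ x → ∀ i, ‖x i‖ ≤ R := by
  obtain ⟨δ, C, m, hδ, hC, hm, hsum⟩ := hD.exists_sum_le
  have hlam := hD.lam_pos
  refine ⟨(C + D.lam₁ / 2 * U ^ 2) / δ, by positivity, fun k θ x hθ hx i => ?_⟩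
  rw [le_div_iff₀ hδ]
  have h1 := hsum k θ x hx
  have h2 : 0 ≤ ∑ i, (D.γ i (x i) - m i) :=
    Finset.sum_nonneg fun i _ => sub_nonneg.2 (hm i _)
  have h3 : ‖x i‖ ≤ ∑ i, ‖x i‖ :=
    Finset.single_le_sum (f := fun i => ‖x i‖) (fun i _ => norm_nonneg _) (Finset.mem_univ i)
  have h4 : D.lam k / 2 * ‖θ‖ ^ 2 ≤ D.lam₁ / 2 * U ^ 2 := by
    have := hD.lam_le k
    gcongr
  have h5 := mul_le_mul_of_nonneg_left h3 hδ.le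
  linarith

theorem continuous_smooth (hD : D.IsAdmissible G L τ) (i : V) : Continuous (D.γ i) :=
  (hD.smooth i).differentiable.continuous

theorem continuous_nonsmooth (hD : D.IsAdmissible G L τ) (i : V) : Continuous (D.ρ i) :=
  continuous_of_convexOn (hD.nonsmooth i).convex

theorem exists_consensus_minimizer (hD : D.IsAdmissible G L τ) :
    ∃ y₀, IsMinOn (fun y => ∑ i, (D.ρ i y + D.γ i y)) Set.univ y₀ := by
  have hne := hD.nonempty
  choose m hm using fun i => (hD.smooth i).bddBelow
  have h1 := fun i => hD.continuous_smooth i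
  have h2 := fun i => hD.continuous_nonsmooth i
  refine exists_isMinOn_of_coercive (a := ∑ i, τ i) (b := -∑ i, m i) (by fun_prop)
    (Finset.sum_pos (fun i _ => (hD.nonsmooth i).tau_pos) Finset.univ_nonempty) fun y => ?_
  rw [sub_neg_eq_add, Finset.sum_mul, ← Finset.sum_add_distrib]
  exact Finset.sum_le_sum fun i _ => add_le_add ((hD.nonsmooth i).coercive y) (hm i y)

/-- The suboptimality and the infeasibility of the iterates of DFAL are `O(c^k)`. -/
theorem exists_rate (hD : D.IsAdmissible G L τ) :
    ∃ C : ℝ, 0 < C ∧ ∀ (x : ℕ → Blocks V n) (k : ℕ),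
      (∀ j < k + 1, D.NearMin j (D.dual x j) (x (j + 1))) →
      D.EpsOptimal (C * D.c ^ k) (x (k + 1)) ∧ EpsFeasible G (C * D.c ^ k) (x (k + 1)) := by
  have hne := hD.nonempty
  have hlam := hD.lam_pos
  have hα := hD.alpha_pos
  have hξ := hD.xi_pos
  obtain ⟨U, hU0, hU⟩ := hD.exists_dual_bound
  obtain ⟨R, hR0, hR⟩ := hD.exists_iterate_bound (U := U)
  obtain ⟨y₀, hy₀⟩ := hD.exists_consensus_minimizer
  choose B hB0 hB using fun i => (hD.nonsmooth i).subdiff_bounded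
  let N : ℝ := Fintype.card V
  let C₁ : ℝ := D.lam₁ / 2 * U ^ 2 + D.alpha₁ / D.lam₁ + D.xi₁ / D.lam₁ * (N * (R + ‖y₀‖))
  let C₂ : ℝ := (∑ i, (B i + (‖gradient (D.γ i) 0‖ + L i * R))) * (N * (D.lam₁ * (2 * U)))
  let C₃ : ℝ := D.lam₁ * (2 * U)
  have hN0 : 0 ≤ N := Nat.cast_nonneg _
  have hS0 : 0 ≤ ∑ i, (B i + (‖gradient (D.γ i) 0‖ + L i * R)) :=
    Finset.sum_nonneg fun i _ => by have := hB0 i; positivity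
  have hC₁ : 0 < C₁ := by positivity
  have hC₂ : 0 ≤ C₂ := by positivity
  have hC₃ : 0 ≤ C₃ := by positivity
  refine ⟨C₁ + C₂ + C₃, by positivity, fun x k hx => ?_⟩
  have hck := pow_pos hD.c_pos k
  have hlk := hD.lam_k_pos k
  have hθ := hU x k fun j hj => hx j (by omega)
  have hθ' := hU x (k + 1) hx
  have hk := hx k (Nat.lt_succ_self k)
  have hRx := hR k _ _ hθ hk
  -- The dual update read backwards: A x is λ times a difference of two bounded dual vectors.
  have hA : ‖D.mulA (x (k + 1))‖ ≤ D.lam₁ * (2 * U) * D.c ^ k := by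
    have h1 : D.mulA (x (k + 1)) = D.lam k • (D.dual x k - D.dual x (k + 1)) := by
      rw [dual, sub_sub_cancel, smul_inv_smul₀ hlk.ne']
    rw [h1, norm_smul, Real.norm_of_nonneg hlk.le, lam]
    have h2 := norm_sub_le (D.dual x k) (D.dual x (k + 1))
    have h3 : ‖D.dual x k - D.dual x (k + 1)‖ ≤ 2 * U := by linarith
    have h4 := mul_le_mul_of_nonneg_left h3 (mul_pos hlam hck).le
    linarith
  have hinf : (⨅ y, ∑ i, (D.ρ i y + D.γ i y)) = ∑ i, (D.ρ i y₀ + D.γ i y₀) := by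
    refine le_antisymm (ciInf_le ⟨∑ i, (D.ρ i y₀ + D.γ i y₀), ?_⟩ y₀) (le_ciInf fun y => hy₀ (Set.mem_univ y))
    rintro _ ⟨y, rfl⟩
    exact hy₀ (Set.mem_univ y)
  refine ⟨?_, fun i j hij => ?_⟩
  · rw [EpsOptimal, hinf, abs_le]
    constructor
    · obtain ⟨i₀⟩ := hne
      -- Lower bound on the cost: put the block of one fixed node at every node, which costs at most
      -- F* less the disagreement times Lipschitz constants on the bounded region.
      have h1 : ∑ i, (D.ρ i y₀ + D.γ i y₀)
          ≤ ∑ i, (D.ρ i (x (k + 1) i₀) + D.γ i (x (k + 1) i₀)) := hy₀ (Set.mem_univ _)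
      have h2 : ∀ i, (D.ρ i (x (k + 1) i₀) + D.γ i (x (k + 1) i₀))
          - (D.ρ i (x (k + 1) i) + D.γ i (x (k + 1) i))
          ≤ (B i + (‖gradient (D.γ i) 0‖ + L i * R)) * (N * (D.lam₁ * (2 * U) * D.c ^ k)) := by
        intro i
        have h3 := sub_le_of_subdiff_bounded (hD.nonsmooth i).convex (hB i)
          (x (k + 1) i₀) (x (k + 1) i)
        have h4 := gradient_mem_subdiff (hD.smooth i).convex (hD.smooth i).differentiable
          (x (k + 1) i₀) (x (k + 1) i)
        have h5 : -inner ℝ (gradient (D.γ i) (x (k + 1) i₀)) (x (k + 1) i - x (k + 1) i₀)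
            ≤ ‖gradient (D.γ i) (x (k + 1) i₀)‖ * ‖x (k + 1) i₀ - x (k + 1) i‖ := by
          rw [norm_sub_rev]
          exact (neg_le_abs _).trans (abs_real_inner_le_norm _ _)
        have h6 : ‖gradient (D.γ i) (x (k + 1) i₀)‖ ≤ ‖gradient (D.γ i) 0‖ + L i * R := by
          have h7 := (hD.smooth i).lipschitz.norm_sub_le (x (k + 1) i₀) 0
          rw [sub_zero] at h7
          have h8 := norm_sub_norm_le (gradient (D.γ i) (x (k + 1) i₀)) (gradient (D.γ i) 0)
          have h9 := mul_le_mul_of_nonneg_left (hRx i₀) (NNReal.coe_nonneg (L i))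
          linarith
        have h7 := mul_le_mul_of_nonneg_right h6 (norm_nonneg (x (k + 1) i₀ - x (k + 1) i))
        have h8 := (norm_sub_le_card_mul hD.connected hD.gram (x (k + 1)) i₀ i).trans
          (mul_le_mul_of_nonneg_left hA hN0)
        have h9 : 0 ≤ B i + (‖gradient (D.γ i) 0‖ + L i * R) := by
          have := hB0 i; positivity
        have h10 := mul_le_mul_of_nonneg_left h8 h9
        linarith
      have h3 := Finset.sum_le_sum fun i (_ : i ∈ Finset.univ) => h2 i
      rw [Finset.sum_sub_distrib, ← Finset.sum_mul] at h3
      have h4 : (∑ i, (B i + (‖gradient (D.γ i) 0‖ + L i * R)))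
          * (N * (D.lam₁ * (2 * U) * D.c ^ k)) = C₂ * D.c ^ k := by simp only [C₂]; ring
      rw [h4] at h3
      have h5 : 0 ≤ (C₁ + C₃) * D.c ^ k := by positivity
      linarith
    -- Upper bound: the consensus minimizer is annihilated by A, so what remains after division by λ
    -- is λ‖θ‖²/2 + α/λ + O(ξ/λ).
    · have h1 := hk fun _ => y₀
      have h0 : D.mulA (fun _ => y₀) = 0 := by
        have := norm_mulA_sq G D hD.gram (fun _ => y₀)
        simpa using this
      simp only [subproblem, smoothPart, h0, zero_sub, norm_neg, norm_smul,
        Real.norm_of_nonneg hlk.le] at h1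
      have h2 : ∑ i, ‖x (k + 1) i - y₀‖ ≤ N * (R + ‖y₀‖) := by
        have : ∑ i, ‖x (k + 1) i - y₀‖ ≤ ∑ _i : V, (R + ‖y₀‖) :=
          Finset.sum_le_sum fun i _ => (norm_sub_le _ _).trans (by linarith [hRx i])
        simpa [N, mul_add] using this
      have h3 := mul_le_mul_of_nonneg_left h2 (hD.xi_k_pos k).le
      have h4 := sq_nonneg ‖D.mulA (x (k + 1)) - D.lam k • D.dual x k‖
      have h5 : ‖D.dual x k‖ ^ 2 ≤ U ^ 2 := by gcongr
      have h6 := mul_le_mul_of_nonneg_left h5 (sq_nonneg (D.lam k))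
      have h7 : D.lam k * (∑ i, D.ρ i (x (k + 1) i) + ∑ i, D.γ i (x (k + 1) i))
          ≤ D.lam k * (∑ i, D.ρ i y₀ + ∑ i, D.γ i y₀ + C₁ * D.c ^ k) := by
        have e : D.lam k * (C₁ * D.c ^ k) = 1 / 2 * (D.lam k ^ 2 * U ^ 2) + D.alpha k
            + D.xi k * (N * (R + ‖y₀‖)) := by
          rw [hD.alpha_eq, hD.xi_eq]
          simp only [C₁, lam]
          ring
        rw [mul_add, mul_add _ _ (C₁ * D.c ^ k), e]
        linarith
      have h8 := le_of_mul_le_mul_left h7 hlk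
      simp only [Finset.sum_add_distrib]
      have h9 : 0 ≤ (C₂ + C₃) * D.c ^ k := by positivity
      linarith
  · refine (norm_sub_le_norm_mulA hD.gram (x (k + 1)) hij).trans (hA.trans ?_)
    have h9 : 0 ≤ (C₁ + C₂) * D.c ^ k := by positivity
    simp only [C₃] at *
    linarith

end IsAdmissible

end Data

end AsyncDFAL

/-! ### Measurability of acceptance and the probability guarantee. -/

namespace AsyncDFAL

theorem pow_le_real_of_cond {Ω : Type*} [MeasurableSpace Ω] (μ : Measure Ω)
    [IsProbabilityMeasure μ] {A : ℕ → Set Ω} (hA : ∀ k, MeasurableSet (A k)) {q : ℝ}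
    (hq : 0 ≤ q) {M : ℕ}
    (h : ∀ k < M, q ≤ (ProbabilityTheory.cond μ {ω | ∀ j < k, ω ∈ A j}).real (A k)) :
    q ^ M ≤ μ.real {ω | ∀ j < M, ω ∈ A j} := by
  have hmeas : ∀ k, MeasurableSet {ω | ∀ j < k, ω ∈ A j} := fun k => by
    have : {ω | ∀ j < k, ω ∈ A j} = ⋂ j, ⋂ _ : j < k, A j := by ext; simp
    rw [this]
    exact MeasurableSet.iInter fun j => MeasurableSet.iInter fun _ => hA j
  induction M with
  | zero => simp
  | succ M ih =>
    have h1 := ih fun k hk => h k (by omega)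
    have h2 := h M (Nat.lt_succ_self M)
    have h3 : {ω | ∀ j < M + 1, ω ∈ A j} = {ω | ∀ j < M, ω ∈ A j} ∩ A M := by
      ext ω
      simp only [Set.mem_ofPred_eq, Set.mem_inter_iff, Nat.forall_lt_succ_right]
    rw [Measure.real, cond_apply (hmeas M), ENNReal.toReal_mul, ENNReal.toReal_inv] at h2
    change q ≤ (μ.real {ω | ∀ j < M, ω ∈ A j})⁻¹ * μ.real ({ω | ∀ j < M, ω ∈ A j} ∩ A M) at h2
    rw [h3, pow_succ']
    -- If the past event is null there is nothing to divide by, but then the induction hypothesis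
    -- already forces q^M = 0.
    rcases eq_or_lt_of_le (measureReal_nonneg (μ := μ) (s := {ω | ∀ j < M, ω ∈ A j})) with h0 | h0
    · rw [← h0] at h1
      have : q ^ M = 0 := le_antisymm h1 (pow_nonneg hq M)
      rw [this, mul_zero]
      exact measureReal_nonneg
    · rw [inv_mul_eq_div, le_div_iff₀ h0] at h2
      exact (mul_le_mul_of_nonneg_left h1 hq).trans h2

namespace Data

variable {V κ : Type*} [Fintype V] [DecidableEq V] [Fintype κ] {n : ℕ}
  {G : SimpleGraph V} [DecidableRel G.Adj] {D : Data V κ n} {L : V → ℝ≥0} {τ : V → ℝ}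

theorem measurable_dual (D : Data V κ n) {Ω : Type*} [MeasurableSpace Ω]
    {x : ℕ → Ω → Blocks V n} (hx : ∀ k, Measurable (x k)) (k : ℕ) :
    Measurable fun ω => D.dual (fun l => x l ω) k := by
  induction k with
  | zero => exact measurable_const
  | succ k ih =>
    have h : Measurable fun ω => D.mulA (x (k + 1) ω) :=
      D.continuous_mulA.measurable.comp (hx (k + 1))
    exact ih.sub (h.const_smul (D.lam k)⁻¹)

namespace IsAdmissible

theorem continuous_subproblem (hD : D.IsAdmissible G L τ) (k : ℕ) :
    Continuous fun p : EuclideanSpace ℝ κ × Blocks V n => D.subproblem k p.1 p.2 := by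
  have h1 := hD.continuous_smooth
  have h2 := hD.continuous_nonsmooth
  have h3 := D.continuous_mulA
  unfold subproblem smoothPart
  fun_prop

theorem exists_isMinOn_subproblem (hD : D.IsAdmissible G L τ) (k : ℕ)
    (θ : EuclideanSpace ℝ κ) : ∃ xs, IsMinOn (D.subproblem k θ) Set.univ xs := by
  have hne := hD.nonempty
  obtain ⟨i₀, hi₀⟩ := Finite.exists_min τ
  choose m hm using fun i => (hD.smooth i).bddBelow
  have hlk := hD.lam_k_pos k
  refine exists_isMinOn_of_coercive (a := D.lam k * τ i₀) (b := -(D.lam k * ∑ i, m i))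
    ((hD.continuous_subproblem k).comp (by fun_prop : Continuous fun x => (θ, x)))
    (mul_pos hlk (hD.nonsmooth i₀).tau_pos) fun x => ?_
  have h1 : τ i₀ * ‖x‖ ≤ ∑ i, D.ρ i (x i) := by
    have h2 : ‖x‖ ≤ ∑ i, ‖x i‖ := by
      refine (pi_norm_le_iff_of_nonneg (Finset.sum_nonneg fun i _ => norm_nonneg _)).2 fun i => ?_
      exact Finset.single_le_sum (f := fun i => ‖x i‖) (fun i _ => norm_nonneg _)
        (Finset.mem_univ i)
    refine (mul_le_mul_of_nonneg_left h2 (hD.nonsmooth i₀).tau_pos.le).trans ?_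
    rw [Finset.mul_sum]
    exact Finset.sum_le_sum fun i _ =>
      (mul_le_mul_of_nonneg_right (hi₀ i) (norm_nonneg _)).trans ((hD.nonsmooth i).coercive _)
  have h2 : ∑ i, m i ≤ ∑ i, D.γ i (x i) := Finset.sum_le_sum fun i _ => hm i _
  have h3 := mul_le_mul_of_nonneg_left (add_le_add h1 h2) hlk.le
  have h4 := sq_nonneg ‖D.mulA x - D.lam k • θ‖
  simp only [subproblem, smoothPart]
  linarith

/-- A minimizer exists, so (a) becomes an intersection of closed conditions, one for each w. -/
theorem condA_iff (hD : D.IsAdmissible G L τ) {k : ℕ} {θ : EuclideanSpace ℝ κ}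
    {x : Blocks V n} :
    D.CondA k θ x ↔ ∀ w, D.subproblem k θ x ≤ D.subproblem k θ w + D.alpha k := by
  constructor
  · rintro ⟨xs, hxs, h⟩ w
    have : D.subproblem k θ xs ≤ D.subproblem k θ w := hxs (Set.mem_univ w)
    linarith
  · intro h
    obtain ⟨xs, hxs⟩ := hD.exists_isMinOn_subproblem k θ
    exact ⟨xs, hxs, by linarith [h xs]⟩

theorem isClosed_condA (hD : D.IsAdmissible G L τ) (k : ℕ) :
    IsClosed {p : EuclideanSpace ℝ κ × Blocks V n | D.CondA k p.1 p.2} := by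
  simp only [hD.condA_iff, Set.ofPred_forall]
  refine isClosed_iInter fun w => isClosed_le (hD.continuous_subproblem k) ?_
  exact ((hD.continuous_subproblem k).comp
    (by fun_prop : Continuous fun p : EuclideanSpace ℝ κ × Blocks V n => (p.1, w))).add
    continuous_const

/-- The subgradients range over compact balls, and projecting a closed set along a compact factor is
a closed map. The nodes can be treated separately since the i-th requirement involves only the i-th
subgradient. -/
theorem isClosed_condB (hD : D.IsAdmissible G L τ) (k : ℕ) :
    IsClosed {p : EuclideanSpace ℝ κ × Blocks V n | D.CondB k p.1 p.2} := by
  choose B hB0 hB using fun i => (hD.nonsmooth i).subdiff_bounded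
  have hset : {p : EuclideanSpace ℝ κ × Blocks V n | D.CondB k p.1 p.2} =
      ⋂ i, Prod.snd '' {s : Metric.closedBall (0 : EuclideanSpace ℝ (Fin n)) (B i) ×
        (EuclideanSpace ℝ κ × Blocks V n) | (∀ y, D.ρ i (s.2.2 i)
          + inner ℝ (s.1 : EuclideanSpace ℝ (Fin n)) (y - s.2.2 i) ≤ D.ρ i y) ∧
          ‖D.lam k • (s.1 : EuclideanSpace ℝ (Fin n)) + (D.lam k • gradient (D.γ i) (s.2.2 i)
            + D.adjA (D.mulA s.2.2 - D.lam k • s.2.1) i)‖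
          ≤ D.xi k / √(Fintype.card V : ℝ)} := by
    ext ⟨θ, x⟩
    simp only [Set.mem_ofPred_eq, Set.mem_iInter, Set.mem_image, Prod.exists, Subtype.exists,
      Metric.mem_closedBall, dist_zero_right]
    constructor
    · rintro ⟨g, hg, hgn⟩ i
      obtain ⟨q, hq, hgq⟩ := hg i
      refine ⟨q, hB i _ q hq, θ, x, ⟨hq, ?_⟩, rfl⟩
      have := hgn i
      rwa [hgq, hD.blockGrad_eq] at this
    · intro h
      choose q hq θ' x' h hx using h
      refine ⟨fun i => D.lam k • q i + blockGrad (D.smoothPart k θ) i x, fun i => ?_, fun i => ?_⟩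
      · obtain ⟨rfl, rfl⟩ := Prod.mk.inj (hx i)
        exact ⟨q i, (h i).1, rfl⟩
      · obtain ⟨h1, h2⟩ := Prod.mk.inj (hx i)
        have := (h i).2
        rwa [h1, h2, ← hD.blockGrad_eq] at this
  rw [hset]
  refine isClosed_iInter fun i => ?_
  have : CompactSpace (Metric.closedBall (0 : EuclideanSpace ℝ (Fin n)) (B i)) :=
    isCompact_iff_compactSpace.1 (isCompact_closedBall _ _)
  refine isClosedMap_snd_of_compactSpace _ ?_
  have h1 := hD.continuous_nonsmooth i
  have h2 := (hD.smooth i).lipschitz.continuous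
  have h3 := D.continuous_mulA
  have h4 : Continuous fun r => D.adjA r i :=
    (continuous_apply i).comp D.adjA.continuous_of_finiteDimensional
  rw [Set.ofPred_and, Set.ofPred_forall]
  refine (isClosed_iInter fun y => isClosed_le (by fun_prop) (by fun_prop)).inter
    (isClosed_le ?_ continuous_const)
  have h5 : Continuous fun s : Metric.closedBall (0 : EuclideanSpace ℝ (Fin n)) (B i) ×
      (EuclideanSpace ℝ κ × Blocks V n) => D.mulA s.2.2 - D.lam k • s.2.1 := by fun_prop
  have h6 := h4.comp h5
  simp only [Function.comp_def] at h6
  fun_prop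

theorem measurableSet_accepted (hD : D.IsAdmissible G L τ) {Ω : Type*} [MeasurableSpace Ω]
    {x : ℕ → Ω → Blocks V n} (hx : ∀ k, Measurable (x k)) (k : ℕ) :
    MeasurableSet {ω | D.Accepted (fun l => x l ω) k} := by
  have h : Measurable fun ω => (D.dual (fun l => x l ω) k, x (k + 1) ω) :=
    (D.measurable_dual hx k).prodMk (hx (k + 1))
  exact (h (hD.isClosed_condA k).measurableSet).union (h (hD.isClosed_condB k).measurableSet)

theorem pow_outerIters_le (hD : D.IsAdmissible G L τ) {C ε : ℝ} (hC : 0 < C) (hε : 0 < ε) :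
    D.c ^ D.outerIters C ε ≤ ε / C := by
  have hc := hD.c_pos
  have hc1 : 1 < 1 / D.c := by rw [lt_div_iff₀ hc]; linarith [hD.c_lt_one]
  have h1 : Real.logb (1 / D.c) (C / ε) ≤ D.outerIters C ε :=
    (Nat.le_ceil _).trans (by exact_mod_cast le_max_right _ _)
  rw [Real.logb_le_iff_le_rpow hc1 (by positivity), Real.rpow_natCast, one_div, inv_pow] at h1
  have h2 := inv_anti₀ (by positivity) h1
  rwa [inv_inv, inv_div] at h2

/-- After `N(ε)` outer iterations the asynchronous variant is `ε`-optimal and `ε`-feasible with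
probability at least `1 - p`. -/
theorem async_guarantee (hD : D.IsAdmissible G L τ) {C : ℝ} (hC : 0 < C)
    (hrate : ∀ (x : ℕ → Blocks V n) (k : ℕ),
      (∀ j < k + 1, D.NearMin j (D.dual x j) (x (j + 1))) →
      D.EpsOptimal (C * D.c ^ k) (x (k + 1)) ∧ EpsFeasible G (C * D.c ^ k) (x (k + 1)))
    {ε : ℝ} (hε : 0 < ε) {p : ℝ} (hp1 : p < 1)
    {Ω : Type*} [MeasurableSpace Ω] (μ : Measure Ω) [IsProbabilityMeasure μ]
    {x : ℕ → Ω → Blocks V n} (hx : ∀ k, Measurable (x k))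
    (hacc : D.AsyncAccepted μ x (D.outerIters (C / D.c) ε) p) :
    1 - p ≤ μ.real {ω | D.EpsOptimal ε (x (D.outerIters (C / D.c) ε) ω) ∧
      EpsFeasible G ε (x (D.outerIters (C / D.c) ε) ω)} := by
  have hc := hD.c_pos
  have hpow := hD.pow_outerIters_le (C := C / D.c) (by positivity) hε
  have hM1 : 1 ≤ D.outerIters (C / D.c) ε := le_max_left _ _
  obtain ⟨k, hk⟩ := Nat.exists_eq_add_of_le' hM1
  rw [hk] at hpow hacc ⊢
  -- With N(ε) = k + 1, the last iterate has accuracy C c^k = (C/c) c^(k+1): hence the constant C/c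
  -- in N(ε).
  have hle : C * D.c ^ k ≤ ε := by
    rw [pow_succ, div_div_eq_mul_div, le_div_iff₀ hC] at hpow
    have : D.c * (C * D.c ^ k) ≤ D.c * ε := by linarith
    exact le_of_mul_le_mul_left this hc
  have hprob := pow_le_real_of_cond μ (fun k => hD.measurableSet_accepted hx k)
    (Real.rpow_nonneg (by linarith : 0 ≤ 1 - p) (1 / ((k + 1 : ℕ) : ℝ))) hacc
  rw [← Real.rpow_natCast, ← Real.rpow_mul (by linarith), one_div,
    inv_mul_cancel₀ (by positivity), Real.rpow_one] at hprob
  refine hprob.trans (measureReal_mono fun ω hω => ?_)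
  obtain ⟨h1, h2⟩ := hrate (fun l => x l ω) k fun j hj => hD.nearMin_of_accepted (hω j hj)
  exact ⟨h1.trans hle, fun i j hij => (h2 i j hij).trans hle⟩

end IsAdmissible

end Data

end AsyncDFAL

/-! ### Independent calls of ARBCD and conditional success probabilities. -/

namespace AsyncDFAL

section Probability

variable {Ω : Type*} [MeasurableSpace Ω] {μ : Measure Ω} [IsProbabilityMeasure μ]

/-- Splitting over the finitely many values q of Q makes the bad set deterministic on each piece,
where independence gives a product. -/
theorem real_mem_inter_le_of_indepFun {α β : Type*} [Finite α] [MeasurableSpace α]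
    [MeasurableSpace β] [DiscreteMeasurableSpace α] [DiscreteMeasurableSpace β] {Q : Ω → α}
    {B : Ω → β} (hQ : Measurable Q) (hind : IndepFun Q B μ) {S : Set α} {Bad : α → Set β}
    {δ : ℝ} (h : ∀ q ∈ S, μ.real {ω | B ω ∈ Bad q} ≤ δ) :
    μ.real {ω | Q ω ∈ S ∧ B ω ∈ Bad (Q ω)} ≤ δ * μ.real {ω | Q ω ∈ S} := by
  classical
  have := Fintype.ofFinite α
  have h1 : {ω | Q ω ∈ S ∧ B ω ∈ Bad (Q ω)} ⊆
      ⋃ q ∈ S.toFinset, (Q ⁻¹' {q} ∩ B ⁻¹' Bad q) := by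
    intro ω hω
    simp only [Set.mem_iUnion, Set.mem_toFinset]
    exact ⟨Q ω, hω.1, rfl, hω.2⟩
  have h2 : {ω | Q ω ∈ S} = Q ⁻¹' (S.toFinset : Set α) := by ext; simp
  rw [h2, ← sum_measureReal_preimage_singleton _ fun y _ => hQ (MeasurableSet.singleton y),
    Finset.mul_sum]
  refine (measureReal_mono h1 (measure_ne_top _ _)).trans ((measureReal_biUnion_finset_le _ _).trans ?_)
  refine Finset.sum_le_sum fun q hq => ?_
  have h3 : μ.real (Q ⁻¹' {q} ∩ B ⁻¹' Bad q) = μ.real (Q ⁻¹' {q}) * μ.real (B ⁻¹' Bad q) := by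
    rw [Measure.real, hind.measure_inter_preimage_eq_mul _ _ (MeasurableSet.of_discrete)
      (MeasurableSet.of_discrete), ENNReal.toReal_mul]
    rfl
  rw [h3, mul_comm]
  exact mul_le_mul_of_nonneg_right (h q (Set.mem_toFinset.1 hq)) measureReal_nonneg

variable {V : Type*} [Fintype V] [DecidableEq V] [Nonempty V] [MeasurableSpace V]
  [DiscreteMeasurableSpace V]

theorem real_eq_of_uniform {a b : ℕ} {f : Fin a × Fin b → Ω → V}
    (hf : iIndepFun f μ) (hunif : ∀ s i, μ.real {ω | f s ω = i} = 1 / (Fintype.card V : ℝ))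
    (h : Fin a → Fin b → V) :
    μ.real {ω | (fun r l => f (r, l) ω) = h} = (1 / (Fintype.card V : ℝ)) ^ (a * b) := by
  have h1 : {ω | (fun r l => f (r, l) ω) = h}
      = ⋂ s ∈ (Finset.univ : Finset (Fin a × Fin b)), f s ⁻¹' {h s.1 s.2} := by
    ext ω
    simp only [Set.mem_ofPred_eq, funext_iff, Finset.mem_univ, Set.iInter_true, Set.mem_iInter,
      Set.mem_preimage, Set.mem_singleton_iff, Prod.forall]
  have h2 : ∀ s, (μ (f s ⁻¹' {h s.1 s.2})).toReal = 1 / (Fintype.card V : ℝ) := fun s =>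
    hunif s _
  rw [h1, Measure.real, hf.measure_inter_preimage_eq_mul _ fun _ _ => MeasurableSet.of_discrete,
    ENNReal.toReal_prod]
  simp [h2]

/-- By independence and uniformity every array of draws is equally likely, so this is counting:
(|Bad| / N^b)^a. -/
theorem real_forall_mem_le {a b : ℕ} {f : Fin a × Fin b → Ω → V} (hm : ∀ s, Measurable (f s))
    (hf : iIndepFun f μ) (hunif : ∀ s i, μ.real {ω | f s ω = i} = 1 / (Fintype.card V : ℝ))
    (Bad : Finset (Fin b → V)) (hBad : 2 * (Bad.card : ℝ) ≤ (Fintype.card V : ℝ) ^ b) :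
    μ.real {ω | ∀ r, (fun l => f (r, l) ω) ∈ Bad} ≤ (1 / 2) ^ a := by
  have hN : (0 : ℝ) < Fintype.card V := by exact_mod_cast Fintype.card_pos
  have hmeas : Measurable fun ω r l => f (r, l) ω :=
    measurable_pi_lambda _ fun r => measurable_pi_lambda _ fun l => hm (r, l)
  have h1 : {ω | ∀ r, (fun l => f (r, l) ω) ∈ Bad}
      = (fun ω r l => f (r, l) ω) ⁻¹' (Fintype.piFinset fun _ : Fin a => Bad : Set _) := by
    ext ω
    simp
  rw [h1, ← sum_measureReal_preimage_singleton _ fun y _ => hmeas (MeasurableSet.singleton y)]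
  have h2 : ∀ h : Fin a → Fin b → V, μ.real ((fun ω r l => f (r, l) ω) ⁻¹' {h})
      = (1 / (Fintype.card V : ℝ)) ^ (a * b) := fun h => real_eq_of_uniform hf hunif h
  simp only [h2, Finset.sum_const, Fintype.card_piFinset, Finset.prod_const, Finset.card_univ,
    Fintype.card_fin, nsmul_eq_mul, Nat.cast_pow]
  rw [mul_comm a b, pow_mul, ← mul_pow]
  refine pow_le_pow_left₀ (by positivity) ?_ a
  rw [one_div, inv_pow, ← div_eq_mul_inv, div_le_div_iff₀ (by positivity) two_pos]
  linarith

end Probability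

theorem bestOf_le {X : Type*} (Φ : X → ℝ) (y : ℕ → X) {K r : ℕ} (hr : r ≤ K) :
    Φ (bestOf Φ y K) ≤ Φ (y r) := by
  induction K with
  | zero => rw [Nat.le_zero.1 hr, bestOf]
  | succ K ih =>
    rw [bestOf]
    rcases Nat.le_succ_iff.1 hr with h | rfl
    · split_ifs with hlt
      · exact hlt.le.trans (ih h)
      · exact ih h
    · split_ifs with hlt
      · exact le_rfl
      · exact not_lt.1 hlt

theorem bestOf_congr {X : Type*} (Φ : X → ℝ) {y y' : ℕ → X} {K : ℕ} (h : ∀ r ≤ K, y r = y' r) :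
    bestOf Φ y K = bestOf Φ y' K := by
  induction K with
  | zero => exact h 0 le_rfl
  | succ K ih =>
    simp only [bestOf]
    rw [ih fun r hr => h r (by omega), h (K + 1) le_rfl]

namespace Data

variable {V κ : Type*} [Fintype V] [DecidableEq V] [Fintype κ] {n : ℕ}
  {G : SimpleGraph V} [DecidableRel G.Adj] {D : Data V κ n} {L : V → ℝ≥0} {τ : V → ℝ}

theorem arbcdRun_congr (D : Data V κ n) (Lip : ℕ → V → ℝ) (K T : ℕ → ℕ) (x0 : Blocks V n)
    {R R' : ℕ → ℕ → ℕ → V} {k : ℕ}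
    (h : ∀ j < k, ∀ r < K j + 1, ∀ l < T j + 1, R j r l = R' j r l) :
    D.arbcdRun Lip K T x0 R k = D.arbcdRun Lip K T x0 R' k := by
  induction k with
  | zero => rfl
  | succ k ih =>
    have h1 := ih fun j hj => h j (by omega)
    simp only [arbcdRun, h1]
    rw [bestOf_congr _ fun r hr => arbcdOutput_congr _ _ _ _ fun m hm =>
      h k (Nat.lt_succ_self k) r (by omega) m hm]

theorem accepted_arbcdRun_congr (D : Data V κ n) (Lip : ℕ → V → ℝ) (K T : ℕ → ℕ)
    (x0 : Blocks V n) {R R' : ℕ → ℕ → ℕ → V} {k : ℕ}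
    (h : ∀ j < k + 1, ∀ r < K j + 1, ∀ l < T j + 1, R j r l = R' j r l) :
    D.Accepted (fun l => (D.arbcdRun Lip K T x0 R l).1) k ↔
      D.Accepted (fun l => (D.arbcdRun Lip K T x0 R' l).1) k := by
  simp only [Accepted, ← arbcdRun_snd]
  rw [arbcdRun_congr D Lip K T x0 h,
    arbcdRun_congr D Lip K T x0 fun j (hj : j < k) => h j (Nat.lt_succ_of_lt hj)]

/-- The indices of the samples used in the outer iteration `k`. -/
def sampleBlock (K T : ℕ → ℕ) (k : ℕ) : Finset (ℕ × ℕ × ℕ) :=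
  {k} ×ˢ Finset.range (K k + 1) ×ˢ Finset.range (T k + 1)

/-- The indices of the samples used before the outer iteration `k`. -/
def samplePast (K T : ℕ → ℕ) (k : ℕ) : Finset (ℕ × ℕ × ℕ) :=
  (Finset.range k).biUnion (sampleBlock K T)

theorem mem_samplePast {K T : ℕ → ℕ} {k j r l : ℕ} :
    (j, r, l) ∈ samplePast K T k ↔ j < k ∧ r < K j + 1 ∧ l < T j + 1 := by
  simp only [samplePast, sampleBlock, Finset.mem_biUnion, Finset.mem_range, Finset.mem_product,
    Finset.mem_singleton]
  constructor
  · rintro ⟨j', h, rfl, h2⟩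
    exact ⟨h, h2⟩
  · rintro ⟨h, h2⟩
    exact ⟨j, h, rfl, h2⟩

theorem disjoint_samplePast (K T : ℕ → ℕ) (k : ℕ) :
    Disjoint (samplePast K T k) (sampleBlock K T k) := by
  rw [Finset.disjoint_left]
  rintro ⟨j, r, l⟩ h1 h2
  rw [mem_samplePast] at h1
  simp only [sampleBlock, Finset.mem_product, Finset.mem_singleton] at h2
  omega

/-- Extension of samples on a finite index set. -/
noncomputable def extendSamples [Nonempty V] {S : Finset (ℕ × ℕ × ℕ)} (h : S → V) (j r l : ℕ) : V :=
  if hm : (j, r, l) ∈ S then h ⟨(j, r, l), hm⟩ else Classical.arbitrary V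

theorem extendSamples_apply [Nonempty V] {K T : ℕ → ℕ} {k : ℕ} (R : ℕ → ℕ → ℕ → V) :
    ∀ j < k, ∀ r < K j + 1, ∀ l < T j + 1, R j r l = extendSamples
      (fun s : samplePast K T k => R s.1.1 s.1.2.1 s.1.2.2) j r l := by
  intro j hj r hr l hl
  rw [extendSamples, dif_pos (mem_samplePast.2 ⟨hj, hr, hl⟩)]

/-- The samples at which a call of ARBCD in outer iteration `k` is not successful. -/
def BadCall (D : Data V κ n) [Nonempty V] (Lip : ℕ → V → ℝ) (K T : ℕ → ℕ) (x0 : Blocks V n)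
    (R : ℕ → ℕ → ℕ → V) (k : ℕ) (s : Fin (T k + 1) → V) : Prop :=
  ¬ D.CondA k (D.arbcdRun Lip K T x0 R k).2
    (arbcdOutput (fun i y => D.lam k * D.ρ i y) (D.smoothPart k (D.arbcdRun Lip K T x0 R k).2)
      (Lip k) (D.arbcdRun Lip K T x0 R k).1 (extendSeq s) (T k))

theorem accepted_of_call [Nonempty V] (Lip : ℕ → V → ℝ) (K T : ℕ → ℕ)
    (x0 : Blocks V n) (R : ℕ → ℕ → ℕ → V) {k r : ℕ} (hr : r < K k + 1)
    (h : ¬ D.BadCall Lip K T x0 R k fun l => R k r l) :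
    D.Accepted (fun l => (D.arbcdRun Lip K T x0 R l).1) k := by
  left
  rw [← arbcdRun_snd]
  obtain ⟨xs, hxs, hle⟩ := not_not.1 h
  refine ⟨xs, hxs, le_trans (sub_le_sub_right ?_ _) hle⟩
  rw [arbcdOutput_congr (idx' := R k r) _ _ _ _ fun m hm => by simp [extendSeq, hm]]
  exact bestOf_le _ (fun r => arbcdOutput _ _ _ _ (R k r) (T k)) (Nat.lt_succ_iff.1 hr)

open Classical in
/-- If at most half of the samples are bad for each call, then DFAL with repeated calls of ARBCD
satisfies the acceptance condition of the asynchronous variant. -/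
theorem asyncAccepted_of_card_badCall [Nonempty V] (D : Data V κ n) (Lip : ℕ → V → ℝ)
    (K T : ℕ → ℕ) (x0 : Blocks V n) {M : ℕ} {p : ℝ} (hp1 : p < 1)
    (hcard : ∀ k < M, ∀ R : ℕ → ℕ → ℕ → V,
      (∀ j < k, D.Accepted (fun l => (D.arbcdRun Lip K T x0 R l).1) j) →
      2 * ((Finset.univ.filter fun s => D.BadCall Lip K T x0 R k s).card : ℝ)
        ≤ (Fintype.card V : ℝ) ^ (T k + 1))
    (hK : ∀ k < M, (1 / 2 : ℝ) ^ (K k + 1) ≤ 1 - (1 - p) ^ (1 / (M : ℝ)))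
    {Ω : Type*} [MeasurableSpace Ω] {μ : Measure Ω} [IsProbabilityMeasure μ]
    {R : Ω → ℕ → ℕ → ℕ → V} (hR : IsUniformSampling μ R) :
    D.AsyncAccepted μ (fun k ω => (D.arbcdRun Lip K T x0 (R ω) k).1) M p := by
  let : MeasurableSpace V := ⊤
  set A : ℕ → Set Ω := fun k =>
    {ω | D.Accepted (fun l => (D.arbcdRun Lip K T x0 (R ω) l).1) k} with hAdef
  set q : ℝ := (1 - p) ^ (1 / (M : ℝ)) with hq
  have hqpos : 0 < q := Real.rpow_pos_of_pos (by linarith) _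
  have hRm : ∀ s : ℕ × ℕ × ℕ, Measurable fun ω => R ω s.1 s.2.1 s.2.2 := fun s =>
    hR.measurable _ _ _
  have hQm : ∀ k, Measurable fun ω => fun s : samplePast K T k => R ω s.1.1 s.1.2.1 s.1.2.2 :=
    fun k => measurable_pi_lambda _ fun s => hRm s.1
  -- Success of all earlier iterations depends only on the finite family of samples indexed by
  -- `samplePast`, which is independent of the samples of iteration k.
  let good : ∀ k, Set (samplePast K T k → V) := fun k =>
    {h | ∀ j < k, D.Accepted (fun l => (D.arbcdRun Lip K T x0 (extendSamples h) l).1) j}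
  have hgood : ∀ k, {ω | ∀ j < k, ω ∈ A j}
      = {ω | (fun s : samplePast K T k => R ω s.1.1 s.1.2.1 s.1.2.2) ∈ good k} := by
    intro k
    ext ω
    simp only [hAdef, good, Set.mem_ofPred_eq]
    exact forall₂_congr fun j hj => D.accepted_arbcdRun_congr Lip K T x0 fun i hi =>
      extendSamples_apply (R ω) i (by omega)
  have hEmeas : ∀ k, MeasurableSet {ω | ∀ j < k, ω ∈ A j} := fun k => by
    rw [hgood]
    exact hQm k MeasurableSet.of_discrete
  have hfail : ∀ k < M, μ.real ({ω | ∀ j < k, ω ∈ A j} \ A k)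
      ≤ (1 - q) * μ.real {ω | ∀ j < k, ω ∈ A j} := by
    intro k hk
    let B : Ω → Fin (K k + 1) → Fin (T k + 1) → V := fun ω r l => R ω k r l
    let ev : Fin (K k + 1) × Fin (T k + 1) → ℕ × ℕ × ℕ := fun s => (k, s.1, s.2)
    have hev : Function.Injective ev := by
      rintro ⟨r, l⟩ ⟨r', l'⟩ h
      simp only [ev, Prod.mk.injEq, true_and] at h
      exact Prod.ext (Fin.ext h.1) (Fin.ext h.2)
    have hind : IndepFun (fun ω => fun s : samplePast K T k => R ω s.1.1 s.1.2.1 s.1.2.2) B μ := by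
      have h1 := hR.indep.indepFun_finset _ _ (disjoint_samplePast K T k) hRm
      have hmem : ∀ (r : Fin (K k + 1)) (l : Fin (T k + 1)),
          (k, (r : ℕ), (l : ℕ)) ∈ sampleBlock K T k := fun r l => by
        simp only [sampleBlock, Finset.mem_product, Finset.mem_singleton, Finset.mem_range]
        exact ⟨trivial, r.2, l.2⟩
      exact h1.comp (φ := id) (ψ := fun (h : sampleBlock K T k → V) (r : Fin (K k + 1))
        (l : Fin (T k + 1)) => h ⟨(k, r, l), hmem r l⟩) measurable_id .of_discrete
    let bad : (samplePast K T k → V) → Set (Fin (K k + 1) → Fin (T k + 1) → V) := fun h =>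
      {s | ∀ r, D.BadCall Lip K T x0 (extendSamples h) k (s r)}
    have hmain := real_mem_inter_le_of_indepFun (hQm k) hind (S := good k) (Bad := bad)
      (δ := 1 - q) fun h hh => by
        have h1 := real_forall_mem_le (μ := μ) (f := fun s ω => R ω (ev s).1 (ev s).2.1 (ev s).2.2)
          (fun s => hRm (ev s)) (hR.indep.precomp hev) (fun s i => hR.uniform _ _ _ i)
          (Finset.univ.filter fun s => D.BadCall Lip K T x0 (extendSamples h) k s)
          (hcard k hk _ hh)
        simp only [Finset.mem_filter, Finset.mem_univ, true_and] at h1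
        exact h1.trans (hK k hk)
    rw [hgood]
    refine (measureReal_mono ?_).trans hmain
    rintro ω ⟨hω1, hω2⟩
    refine ⟨hω1, fun r => ?_⟩
    by_contra hbad
    refine hω2 (accepted_of_call Lip K T x0 (R ω) r.2 ?_)
    rwa [BadCall, arbcdRun_congr D Lip K T x0 (extendSamples_apply (R ω))]
  have hstep : ∀ k < M, q * μ.real {ω | ∀ j < k, ω ∈ A j}
      ≤ μ.real ({ω | ∀ j < k, ω ∈ A j} ∩ A k) := by
    intro k hk
    have h1 := hfail k hk
    have h2 := measureReal_union_le (μ := μ) ({ω | ∀ j < k, ω ∈ A j} ∩ A k)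
      ({ω | ∀ j < k, ω ∈ A j} \ A k)
    rw [Set.inter_union_sdiff] at h2
    linarith
  -- `cond` on a null event is the zero measure, so the past must be shown to have positive
  -- probability; this uses q > 0, that is p < 1.
  have hpos : ∀ k ≤ M, 0 < μ.real {ω | ∀ j < k, ω ∈ A j} := by
    intro k
    induction k with
    | zero => intro _; simp
    | succ k ih =>
      intro hk
      have h3 : {ω | ∀ j < k + 1, ω ∈ A j} = {ω | ∀ j < k, ω ∈ A j} ∩ A k := by
        ext ω
        simp only [Set.mem_ofPred_eq, Set.mem_inter_iff, Nat.forall_lt_succ_right]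
      rw [h3]
      exact (mul_pos hqpos (ih (by omega))).trans_le (hstep k (by omega))
  intro k hk
  change q ≤ (ProbabilityTheory.cond μ {ω | ∀ j < k, ω ∈ A j}).real (A k)
  rw [Measure.real, cond_apply (hEmeas k), ENNReal.toReal_mul, ENNReal.toReal_inv]
  change q ≤ (μ.real {ω | ∀ j < k, ω ∈ A j})⁻¹ * μ.real ({ω | ∀ j < k, ω ∈ A j} ∩ A k)
  rw [inv_mul_eq_div, le_div_iff₀ (hpos k hk.le)]
  exact hstep k hk

/-- The iterate factors through finitely many samples, hence through a finite discrete space, on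
which every map is measurable. -/
theorem measurable_arbcdRun [Nonempty V] (D : Data V κ n) (Lip : ℕ → V → ℝ) (K T : ℕ → ℕ)
    (x0 : Blocks V n) {Ω : Type*} [MeasurableSpace Ω] {μ : Measure Ω}
    {R : Ω → ℕ → ℕ → ℕ → V} (hR : IsUniformSampling μ R) (k : ℕ) :
    Measurable fun ω => (D.arbcdRun Lip K T x0 (R ω) k).1 := by
  let : MeasurableSpace V := ⊤
  have hQm : Measurable fun ω => fun s : samplePast K T k => R ω s.1.1 s.1.2.1 s.1.2.2 :=
    measurable_pi_lambda _ fun s => hR.measurable _ _ _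
  have h : (fun ω => (D.arbcdRun Lip K T x0 (R ω) k).1)
      = (fun h => (D.arbcdRun Lip K T x0 (extendSamples h) k).1) ∘
        fun ω => fun s : samplePast K T k => R ω s.1.1 s.1.2.1 s.1.2.2 := by
    funext ω
    exact congrArg Prod.fst (arbcdRun_congr D Lip K T x0 (extendSamples_apply (R ω)))
  rw [h]
  exact Measurable.comp .of_discrete hQm

end Data

end AsyncDFAL

/-! ### Counting the ARBCD iterations. -/

namespace AsyncDFAL

/-- A number of repetitions, logarithmic in `M / p`, that makes the failure probability at most
`1 - (1 - p)^(1/M)`. -/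
theorem exists_repetitions {M : ℕ} (hM : 1 ≤ M) {p : ℝ} (hp0 : 0 < p) (hp1 : p < 1) :
    ∃ K : ℕ, (1 / 2 : ℝ) ^ (K + 1) ≤ 1 - (1 - p) ^ (1 / (M : ℝ)) ∧
      (K : ℝ) + 1 ≤ 2 + (Real.log M + Real.log (1 / p)) / Real.log 2 := by
  have hM' : (1 : ℝ) ≤ M := by exact_mod_cast hM
  have hMp : 1 ≤ M / p := by rw [le_div_iff₀ hp0]; linarith
  have hMp0 : 0 < M / p := by linarith
  have hlog2 : 0 < Real.log 2 := Real.log_pos one_lt_two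
  refine ⟨⌈Real.logb 2 (M / p)⌉₊, ?_, ?_⟩
  · have h1 : (M / p : ℝ) ≤ 2 ^ ⌈Real.logb 2 (M / p)⌉₊ := by
      rw [← Real.rpow_natCast, ← Real.logb_le_iff_le_rpow one_lt_two hMp0]
      exact Nat.le_ceil _
    have h2 : (1 / 2 : ℝ) ^ (⌈Real.logb 2 (M / p)⌉₊ + 1) ≤ p / M := by
      refine (pow_le_pow_of_le_one (by norm_num) (by norm_num) (Nat.le_succ _)).trans ?_
      rw [one_div, inv_pow, ← inv_div (M : ℝ) p]
      exact inv_anti₀ hMp0 h1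
    -- Bernoulli's inequality for exponents in [0, 1]: (1 - p)^(1/M) ≤ 1 - p/M.
    have h3 := rpow_one_add_le_one_add_mul_self (s := -p) (by linarith) (p := 1 / (M : ℝ))
      (by positivity) (by rw [div_le_one (by linarith)]; exact hM')
    rw [← sub_eq_add_neg] at h3
    have h4 : 1 / (M : ℝ) * -p = -(p / M) := by ring
    linarith
  · have h1 := (Nat.ceil_lt_add_one (Real.logb_nonneg one_lt_two hMp)).le
    have h2 : Real.logb 2 (M / p) = (Real.log M + Real.log (1 / p)) / Real.log 2 := by
      rw [Real.logb, Real.log_div (by linarith) hp0.ne', one_div, Real.log_inv]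
      ring
    linarith

namespace Data

variable {V κ : Type*} [Fintype V] [DecidableEq V] [Fintype κ] {n : ℕ}
  {G : SimpleGraph V} [DecidableRel G.Adj] {D : Data V κ n} {L : V → ℝ≥0} {τ : V → ℝ}

namespace IsAdmissible

/-- The total number of ARBCD iterations, when outer iteration `k` performs `O(c^{-k})` iterations
in each of a logarithmic number of calls. -/
theorem exists_budget (hD : D.IsAdmissible G L τ) {Cbar Tc : ℝ} (hCbar : 0 < Cbar)
    (hTc : 0 < Tc) :
    ∃ B ε₀ : ℝ, 0 < B ∧ 0 < ε₀ ∧ ∀ ε : ℝ, 0 < ε → ε < ε₀ → ∀ p : ℝ, 0 < p → p < 1 →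
      ∃ K : ℕ, (1 / 2 : ℝ) ^ (K + 1) ≤ 1 - (1 - p) ^ (1 / (D.outerIters Cbar ε : ℝ)) ∧
        ∀ T : ℕ → ℕ, (∀ k, (T k : ℝ) + 1 ≤ Tc / D.c ^ k) →
        (∑ k ∈ Finset.range (D.outerIters Cbar ε), (((K + 1) * (T k + 1) : ℕ) : ℝ)) ≤
          B * (1 / ε) * (Real.log (1 / p) + Real.log (Real.log (1 / ε))) := by
  have hc := hD.c_pos
  have hr : 1 < 1 / D.c := by rw [lt_div_iff₀ hc]; linarith [hD.c_lt_one]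
  set r := 1 / D.c with hrdef
  have hl : 0 < Real.log r := Real.log_pos hr
  have hlog2 : 0 < Real.log 2 := Real.log_pos one_lt_two
  set a := |Real.log Cbar| with hadef
  have ha : 0 ≤ a := abs_nonneg _
  have hr1 : 0 < r - 1 := by linarith
  set B₀ : ℝ := Tc * (r * Cbar / (r - 1)) with hB₀
  have hB₀pos : 0 < B₀ := by positivity
  -- The threshold makes Y = log(1/ε) so large that log(Cbar/ε) ≥ 0, that N(ε) ≤ Y², and that log Y
  -- ≥ 1.
  refine ⟨(2 + 2 / Real.log 2) * B₀, Real.exp (-(a + (a + 1) / Real.log r + 4)), by positivity,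
    Real.exp_pos _, fun ε hε hε₀ p hp0 hp1 => ?_⟩
  set Y := Real.log (1 / ε) with hY
  have hYlb : a + (a + 1) / Real.log r + 4 < Y := by
    rw [hY, one_div, Real.log_inv]
    have := (Real.log_lt_iff_lt_exp hε).2 hε₀
    linarith
  have hq0 : 0 ≤ (a + 1) / Real.log r := by positivity
  have hlogdiv : Real.log (Cbar / ε) = Real.log Cbar + Y := by
    rw [Real.log_div hCbar.ne' hε.ne', hY, one_div, Real.log_inv]; ring
  have hlogC := abs_le.1 (le_refl |Real.log Cbar|)
  rw [← hadef] at hlogC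
  have hlogb0 : 0 ≤ Real.logb r (Cbar / ε) := by
    rw [Real.logb, hlogdiv]
    exact div_nonneg (by linarith) hl.le
  set M := D.outerIters Cbar ε with hM
  have hM1 : 1 ≤ M := le_max_left _ _
  have hMub : (M : ℝ) ≤ Real.logb r (Cbar / ε) + 1 := by
    rw [hM, outerIters, Nat.cast_max, Nat.cast_one]
    exact max_le (by linarith) (Nat.ceil_lt_add_one hlogb0).le
  -- The true order is Y; the crude square avoids constants and costs only a factor 2 after taking
  -- logarithms.
  have hMY : (M : ℝ) ≤ Y ^ 2 := by
    have h1 : Real.logb r (Cbar / ε) ≤ (a + Y) / Real.log r := by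
      rw [Real.logb, hlogdiv]
      exact div_le_div_of_nonneg_right (by linarith) hl.le
    have h2 : (a + Y) / Real.log r ≤ Y * ((a + 1) / Real.log r) := by
      rw [← mul_div_assoc]
      exact div_le_div_of_nonneg_right (by nlinarith) hl.le
    nlinarith
  have hYpos : 0 < Y := by linarith
  have hlogY : 1 ≤ Real.log Y := by
    rw [Real.le_log_iff_exp_le hYpos]
    linarith [Real.exp_one_lt_d9]
  have hlogM : Real.log M ≤ 2 * Real.log Y := by
    have h1 := Real.log_le_log (by exact_mod_cast hM1) hMY
    rwa [Real.log_pow, Nat.cast_ofNat] at h1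
  obtain ⟨K, hK1, hK2⟩ := exists_repetitions hM1 hp0 hp1
  refine ⟨K, hK1, fun T hT => ?_⟩
  have hlogp : 0 ≤ Real.log (1 / p) := Real.log_nonneg (by rw [le_div_iff₀ hp0]; linarith)
  -- The additive 2 is absorbed by 2 log Y, as log Y ≥ 1.
  have hKub : (K : ℝ) + 1 ≤ (2 + 2 / Real.log 2) * (Real.log (1 / p) + Real.log Y) := by
    have h1 : (Real.log M + Real.log (1 / p)) / Real.log 2
        ≤ 2 / Real.log 2 * (Real.log (1 / p) + Real.log Y) := by
      rw [div_mul_eq_mul_div]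
      exact div_le_div_of_nonneg_right (by linarith) hlog2.le
    rw [add_mul]
    linarith
  have hpow : r ^ M ≤ r * (Cbar / ε) := by
    have h1 : (r : ℝ) ^ (M : ℝ) ≤ r ^ (Real.logb r (Cbar / ε) + 1) :=
      Real.rpow_le_rpow_of_exponent_le hr.le hMub
    rw [Real.rpow_add (by linarith), Real.rpow_logb (by linarith) hr.ne' (by positivity),
      Real.rpow_one, Real.rpow_natCast] at h1
    linarith
  -- The geometric sum is of the order of r^M, and N(ε) exceeds log_r(Cbar/ε) by at most 1.
  have hTsum : ∑ k ∈ Finset.range M, ((T k : ℝ) + 1) ≤ B₀ * (1 / ε) := by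
    calc ∑ k ∈ Finset.range M, ((T k : ℝ) + 1) ≤ ∑ k ∈ Finset.range M, Tc * r ^ k := by
          refine Finset.sum_le_sum fun k _ => (hT k).trans_eq ?_
          rw [hrdef, one_div, inv_pow, div_eq_mul_inv]
      _ = Tc * ((r ^ M - 1) / (r - 1)) := by
          rw [← Finset.mul_sum, geom_sum_eq hr.ne']
      _ ≤ Tc * (r * (Cbar / ε) / (r - 1)) := by
          refine mul_le_mul_of_nonneg_left ?_ hTc.le
          exact div_le_div_of_nonneg_right (by linarith) hr1.le
      _ = B₀ * (1 / ε) := by rw [hB₀]; ring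
  have hsum : (∑ k ∈ Finset.range M, (((K + 1) * (T k + 1) : ℕ) : ℝ))
      = ((K : ℝ) + 1) * ∑ k ∈ Finset.range M, ((T k : ℝ) + 1) := by
    rw [Finset.mul_sum]
    exact Finset.sum_congr rfl fun k _ => by push_cast; ring
  rw [hsum]
  refine (mul_le_mul hKub hTsum (Finset.sum_nonneg fun k _ => by positivity)
    (by positivity)).trans_eq ?_
  ring

/-- The distance of the starting points of the ARBCD calls to the solutions of the subproblems,
in the sense relevant for ARBCD, is bounded along successful runs. -/
theorem exists_start_bound (hD : D.IsAdmissible G L τ) (U R : ℝ) :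
    ∃ H : ℝ, 0 < H ∧ ∀ k θ (x xs : Blocks V n), ‖θ‖ ≤ U → ‖x‖ ≤ R → ‖xs‖ ≤ R →
      2 * ((D.subproblem k θ x - D.subproblem k θ xs)
        + ∑ i, (D.lam k * L i + G.degree i) / 2 * ‖x i - xs i‖ ^ 2) ≤ H := by
  have h1 := hD.continuous_smooth
  have h2 := hD.continuous_nonsmooth
  have hlam := hD.lam_pos
  obtain ⟨S, hS⟩ := (isCompact_closedBall (0 : Blocks V n) R).exists_bound_of_continuousOn
    (f := fun x : Blocks V n => ∑ i, D.ρ i (x i) + ∑ i, D.γ i (x i))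
    (by fun_prop : Continuous _).continuousOn
  obtain ⟨S', hS'⟩ := (isCompact_closedBall (0 : Blocks V n) R).exists_bound_of_continuousOn
    (f := D.mulA) D.continuous_mulA.continuousOn
  let H₀ : ℝ := 2 * (2 * (D.lam₁ * |S|) + 1 / 2 * (S' + D.lam₁ * U) ^ 2
    + ∑ i, (D.lam₁ * L i + G.degree i) / 2 * (2 * R) ^ 2)
  refine ⟨|H₀| + 1, by positivity, fun k θ x xs hθ hx hxs => ?_⟩
  refine le_trans ?_ ((le_abs_self H₀).trans (by linarith))
  have hlk := hD.lam_k_pos k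
  have hle := hD.lam_le k
  have hb : ∀ y : Blocks V n, ‖y‖ ≤ R →
      |D.lam k * (∑ i, D.ρ i (y i) + ∑ i, D.γ i (y i))| ≤ D.lam₁ * |S| := by
    intro y hy
    have h3 := hS y (mem_closedBall_zero_iff.2 hy)
    rw [Real.norm_eq_abs] at h3
    rw [abs_mul, abs_of_pos hlk]
    exact mul_le_mul hle (h3.trans (le_abs_self S)) (abs_nonneg _) hlam.le
  have h3 := (abs_le.1 (hb x hx)).2
  have h4 := (abs_le.1 (hb xs hxs)).1
  have h5 : ‖D.mulA x - D.lam k • θ‖ ≤ S' + D.lam₁ * U := by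
    refine (norm_sub_le _ _).trans (add_le_add (hS' x (mem_closedBall_zero_iff.2 hx)) ?_)
    rw [norm_smul, Real.norm_of_nonneg hlk.le]
    exact mul_le_mul hle hθ (norm_nonneg _) hlam.le
  have h6 : ‖D.mulA x - D.lam k • θ‖ ^ 2 ≤ (S' + D.lam₁ * U) ^ 2 := by gcongr
  have h7 := sq_nonneg ‖D.mulA xs - D.lam k • θ‖
  have h8 : ∑ i, (D.lam k * L i + G.degree i) / 2 * ‖x i - xs i‖ ^ 2
      ≤ ∑ i, (D.lam₁ * L i + G.degree i) / 2 * (2 * R) ^ 2 := by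
    refine Finset.sum_le_sum fun i _ => ?_
    have h9 : ‖x i - xs i‖ ≤ 2 * R := by
      have := (norm_le_pi_norm x i).trans hx
      have := (norm_le_pi_norm xs i).trans hxs
      linarith [norm_sub_le (x i) (xs i)]
    have h10 : 0 ≤ D.lam₁ * L i := by positivity
    gcongr
  simp only [subproblem, smoothPart, H₀]
  linarith

open Classical in
theorem card_badCall_le [Nontrivial V] (hD : D.IsAdmissible G L τ) {K T : ℕ → ℕ}
    {x0 : Blocks V n} {R : ℕ → ℕ → ℕ → V} {k : ℕ} {xs : Blocks V n}
    (hxs : IsMinOn (D.subproblem k (D.arbcdRun (fun k i => D.lam k * L i + G.degree i)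
      K T x0 R k).2) Set.univ xs)
    (hT : 2 * ((D.subproblem k (D.arbcdRun (fun k i => D.lam k * L i + G.degree i) K T x0 R k).2
          (D.arbcdRun (fun k i => D.lam k * L i + G.degree i) K T x0 R k).1
        - D.subproblem k (D.arbcdRun (fun k i => D.lam k * L i + G.degree i) K T x0 R k).2 xs)
        + ∑ i, (D.lam k * L i + G.degree i) / 2 *
          ‖(D.arbcdRun (fun k i => D.lam k * L i + G.degree i) K T x0 R k).1 i - xs i‖ ^ 2)
      ≤ stepSize (Fintype.card V) (T k) ^ 2 * D.alpha k) :
    2 * ((Finset.univ.filter fun s =>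
      D.BadCall (fun k i => D.lam k * L i + G.degree i) K T x0 R k s).card : ℝ)
        ≤ (Fintype.card V : ℝ) ^ (T k + 1) := by
  set θ := (D.arbcdRun (fun k i => D.lam k * L i + G.degree i) K T x0 R k).2 with hθ
  set x := (D.arbcdRun (fun k i => D.lam k * L i + G.degree i) K T x0 R k).1 with hx
  have hsub : ∀ y, ∑ i, D.lam k * D.ρ i (y i) + D.smoothPart k θ y = D.subproblem k θ y :=
    fun y => by rw [subproblem, Finset.mul_sum]
  have h := card_not_optimal_le (hD.isCompositeProblem k θ) (z0 := x) (w := xs) (T := T k)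
    (hD.alpha_k_pos k) (fun y => by rw [hsub, hsub]; exact hxs (Set.mem_univ y))
    (by rw [hsub, hsub]; exact hT)
  refine le_trans (mul_le_mul_of_nonneg_left ?_ two_pos.le) h
  refine Nat.cast_le.2 (Finset.card_le_card fun s hs => ?_)
  simp only [Finset.mem_filter, Finset.mem_univ, true_and] at hs ⊢
  rw [hsub, hsub]
  by_contra hle
  exact hs ⟨xs, hxs, not_lt.1 hle⟩

theorem exists_arbcd_complexity [Nontrivial V] (hD : D.IsAdmissible G L τ) {Cbar : ℝ}
    (hCbar : 0 < Cbar) (x0 : Blocks V n) :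
    ∃ B ε₀ : ℝ, 0 < B ∧ 0 < ε₀ ∧ ∀ ε : ℝ, 0 < ε → ε < ε₀ → ∀ p : ℝ, 0 < p → p < 1 →
      ∃ K T : ℕ → ℕ,
        (∑ k ∈ Finset.range (D.outerIters Cbar ε), (((K k + 1) * (T k + 1) : ℕ) : ℝ)) ≤
          B * (1 / ε) * (Real.log (1 / p) + Real.log (Real.log (1 / ε))) ∧
        ∀ {Ω : Type*} [MeasurableSpace Ω] (μ : Measure Ω) [IsProbabilityMeasure μ]
          (R : Ω → ℕ → ℕ → ℕ → V), IsUniformSampling μ R →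
          D.AsyncAccepted μ (fun k ω => (D.arbcdRun (fun k i => D.lam k * L i + G.degree i)
            K T x0 (R ω) k).1) (D.outerIters Cbar ε) p := by
  obtain ⟨U, hU0, hU⟩ := hD.exists_dual_bound
  obtain ⟨R₀, hR₀, hR⟩ := hD.exists_iterate_bound (U := U)
  -- Acceptance says nothing about x⁽⁰⁾, so its norm enters the radius; this is why the budget
  -- depends on the starting point.
  obtain ⟨H, hH, hstart⟩ := hD.exists_start_bound U (max R₀ ‖x0‖)
  have hN : (0 : ℝ) < Fintype.card V := by exact_mod_cast Fintype.card_pos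
  have hα := hD.alpha_pos
  -- A call needs t² α ≥ H, that is t ≥ √(H/α₁)/c^k, and t grows at least like T/(2N).
  set Q : ℝ := 2 * Fintype.card V * √(H / D.alpha₁) with hQ
  have hQ0 : 0 ≤ Q := by positivity
  -- The 2 in Q + 2 pays for rounding T up and for the extra iteration in T + 1.
  obtain ⟨B, ε₀, hB, hε₀, hbudget⟩ := hD.exists_budget hCbar (by positivity : 0 < Q + 2)
  refine ⟨B, ε₀, hB, hε₀, fun ε hε hεlt p hp0 hp1 => ?_⟩
  obtain ⟨K, hK, hsum⟩ := hbudget ε hε hεlt p hp0 hp1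
  let T : ℕ → ℕ := fun k => ⌈Q / D.c ^ k⌉₊
  refine ⟨fun _ => K, T, hsum T fun k => ?_, ?_⟩
  · have hck := pow_pos hD.c_pos k
    have h1 := (Nat.ceil_lt_add_one (by positivity : 0 ≤ Q / D.c ^ k)).le
    have h2 : 2 ≤ 2 / D.c ^ k := by
      rw [le_div_iff₀ hck]; linarith [hD.pow_le_one k]
    rw [add_div]
    simp only [T]
    linarith
  · intro Ω _ μ _ R hRs
    refine D.asyncAccepted_of_card_badCall _ (fun _ => K) T x0 hp1 (fun k _ R' hacc => ?_)
      (fun k _ => hK) hRs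
    set run := D.arbcdRun (fun k i => D.lam k * L i + G.degree i) (fun _ => K) T x0 R' with hrun
    have hdual : ∀ k, (run k).2 = D.dual (fun l => (run l).1) k := fun k => D.arbcdRun_snd ..
    have hnear : ∀ j < k, D.NearMin j (D.dual (fun l => (run l).1) j) (run (j + 1)).1 :=
      fun j hj => hD.nearMin_of_accepted (hacc j hj)
    have hθ : ‖(run k).2‖ ≤ U := by
      rw [hdual]; exact hU _ k hnear
    have hx : ‖(run k).1‖ ≤ max R₀ ‖x0‖ := by
      rcases k with _ | k
      · exact le_max_right _ _
      · refine le_trans ?_ (le_max_left _ _)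
        refine (pi_norm_le_iff_of_nonneg hR₀).2 (hR k _ _ (hU _ k fun j hj => ?_)
          (hnear k (Nat.lt_succ_self k)))
        exact hnear j (by omega)
    obtain ⟨xs, hxs⟩ := hD.exists_isMinOn_subproblem k (run k).2
    have hxsR : ‖xs‖ ≤ max R₀ ‖x0‖ := by
      refine le_trans ((pi_norm_le_iff_of_nonneg hR₀).2 (hR k _ _ hθ ?_)) (le_max_left _ _)
      exact hD.nearMin_of_isMinOn hxs (by rw [sub_self]; exact (hD.alpha_k_pos k).le)
    refine hD.card_badCall_le hxs ((hstart k _ _ _ hθ hx hxsR).trans ?_)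
    have hck := pow_pos hD.c_pos k
    have h1 := stepSize_ge hN (T k)
    have h2 : √(H / D.alpha₁) / D.c ^ k ≤ stepSize (Fintype.card V) (T k) := by
      have h3 : Q / D.c ^ k ≤ T k := Nat.le_ceil _
      have h4 : √(H / D.alpha₁) / D.c ^ k = Q / D.c ^ k / (2 * Fintype.card V) := by
        rw [hQ]; field_simp
      have h5 := div_le_div_of_nonneg_right h3 (by positivity : 0 ≤ 2 * (Fintype.card V : ℝ))
      linarith
    have h3 : (√(H / D.alpha₁) / D.c ^ k) ^ 2 ≤ stepSize (Fintype.card V) (T k) ^ 2 := by gcongr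
    have h4 : (√(H / D.alpha₁) / D.c ^ k) ^ 2 * D.alpha k = H := by
      rw [div_pow, Real.sq_sqrt (by positivity), alpha, ← pow_mul, ← pow_mul, mul_comm k]
      have := (pow_pos hD.c_pos (2 * k)).ne'
      field_simp
    rw [← h4]
    exact mul_le_mul_of_nonneg_right h3 (hD.alpha_k_pos k).le

end IsAdmissible

end Data

end AsyncDFAL

theorem mainTheorem6 {V κ : Type*} [Fintype V] [DecidableEq V] [Nontrivial V] [Fintype κ] {n : ℕ}
    (G : SimpleGraph V) [DecidableRel G.Adj] (hG : G.Connected)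
    (D : AsyncDFAL.Data V κ n) (L : V → ℝ≥0) (τ : V → ℝ)
    (hγ : ∀ i, AsyncDFAL.IsSmoothTerm (D.γ i) (L i))
    (hρ : ∀ i, AsyncDFAL.IsNonsmoothTerm (D.ρ i) (τ i))
    (hA : D.Aᵀ * D.A = G.lapMatrix ℝ ⊗ₖ (1 : Matrix (Fin n) (Fin n) ℝ))
    (hc₀ : 0 < D.c) (hc₁ : D.c < 1) (hlam : 0 < D.lam₁) (halpha : 0 < D.alpha₁)
    (hxi : 0 < D.xi₁) (hxi_lam : ∀ i, D.xi₁ / D.lam₁ < τ i) :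
    ∃ Cbar : ℝ, 0 < Cbar ∧
      -- every asynchronous variant is `ε`-optimal and `ε`-feasible after `N(ε)` outer iterations
      (∀ ε : ℝ, 0 < ε → ∀ p : ℝ, 0 < p → p < 1 →
        ∀ (Ω : Type*) [MeasurableSpace Ω] (μ : Measure Ω) [IsProbabilityMeasure μ]
          (x : ℕ → Ω → AsyncDFAL.Blocks V n), (∀ k, Measurable (x k)) →
          D.AsyncAccepted μ x (D.outerIters Cbar ε) p →
          1 - p ≤ μ.real {ω | D.EpsOptimal ε (x (D.outerIters Cbar ε) ω) ∧
            AsyncDFAL.EpsFeasible G ε (x (D.outerIters Cbar ε) ω)}) ∧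
      -- the ARBCD implementation and its total number of ARBCD iterations
      (∀ x0 : AsyncDFAL.Blocks V n, ∃ M ε₀ : ℝ, 0 < M ∧ 0 < ε₀ ∧
        ∀ ε : ℝ, 0 < ε → ε < ε₀ → ∀ p : ℝ, 0 < p → p < 1 →
        ∃ K T : ℕ → ℕ,
          (∑ k ∈ Finset.range (D.outerIters Cbar ε), (((K k + 1) * (T k + 1) : ℕ) : ℝ)) ≤
            M * (1 / ε) * (Real.log (1 / p) + Real.log (Real.log (1 / ε))) ∧
          ∀ (Ω : Type*) [MeasurableSpace Ω] (μ : Measure Ω) [IsProbabilityMeasure μ]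
            (R : Ω → ℕ → ℕ → ℕ → V), AsyncDFAL.IsUniformSampling μ R →
            ∀ x : ℕ → Ω → AsyncDFAL.Blocks V n,
              (∀ k ω, x k ω =
                (D.arbcdRun (fun k i => D.lam k * L i + G.degree i) K T x0 (R ω) k).1) →
              D.AsyncAccepted μ x (D.outerIters Cbar ε) p ∧
              1 - p ≤ μ.real {ω | D.EpsOptimal ε (x (D.outerIters Cbar ε) ω) ∧
                AsyncDFAL.EpsFeasible G ε (x (D.outerIters Cbar ε) ω)}) := by
  have hD : D.IsAdmissible G L τ := ⟨hG, hγ, hρ, hA, hc₀, hc₁, hlam, halpha, hxi, hxi_lam⟩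
  obtain ⟨C, hC, hrate⟩ := hD.exists_rate
  refine ⟨C / D.c, by positivity, fun ε hε p _ hp1 Ω _ μ _ x hx hacc =>
    hD.async_guarantee hC hrate hε hp1 μ hx hacc, fun x0 => ?_⟩
  obtain ⟨B, ε₀, hB, hε₀, h⟩ :=
    hD.exists_arbcd_complexity (by positivity : 0 < C / D.c) x0
  refine ⟨B, ε₀, hB, hε₀, fun ε hε hεlt p hp0 hp1 => ?_⟩
  obtain ⟨K, T, hsum, hacc⟩ := h ε hε hεlt p hp0 hp1
  refine ⟨K, T, hsum, fun Ω _ μ _ R hR x hx => ?_⟩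
  have hxrun : x = fun k ω => (D.arbcdRun (fun k i => D.lam k * L i + G.degree i)
      K T x0 (R ω) k).1 := funext fun k => funext (hx k)
  have hmeas : ∀ k, Measurable (x k) := fun k => by
    rw [hxrun]
    exact D.measurable_arbcdRun _ K T x0 hR k
  have hacc' : D.AsyncAccepted μ x (D.outerIters (C / D.c) ε) p := by
    rw [hxrun]
    exact hacc μ R hR
  exact ⟨hacc', hD.async_guarantee hC hrate hε hp1 μ hmeas hacc'⟩
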